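/- Let $d\ge 1$. Let $K_d$ be the optimal constant in the Lieb--Thirring inequality, that is, the largest constant such that for all $N\in\mathbb N$ and all $u_1,\dots,u_N\in H^1(\mathbb R^d)$ (complex-valued) that are orthonormal in $L^2(\mathbb R^d)$, $$\sum_{n=1}^N\int_{\mathbb R^d}|\nabla u_n|^2\,dx\;\ge\; K_d\int_{\mathbb R^d}\Big(\sum_{n=1}^N|u_n|^2\Big)^{1+\frac2d}dx .$$ Then $0<K_d<\infty$, and the following holds for every $N\ge1$. Let $\psi\in H^1(\mathbb R^{dN})$ be a complex-valued antisymmetric function, that is, $\psi(x_{\sigma(1)},\dots,x_{\sigma(N)})=(\operatorname{sgn}\sigma)\,\psi(x_1,\dots,x_N)$ for every permutation $\sigma$ of $\{1,\dots,N\}$ and almost every $(x_1,\dots,x_N)\in(\mathbb R^d)^N=\mathbb R^{dN}$, and let $$\rho_\psi(x)=\sum_{n=1}^N\int_{\mathbb R^{d(N-1)}}|\psi(x_1,\dots,x_{n-1},x,x_{n+1},\dots,x_N)|^2\,dx_1\cdots dx_{n-1}\,dx_{n+1}\cdots dx_N$$ be its one-particle density. Then $$\int_{\mathbb R^{dN}}|\nabla\psi|^2\,dx_1\cdots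 dx_N\;\ge\; K_d\,\|\psi\|_2^{-\frac4d}\int_{\mathbb R^d}\rho_\psi(x)^{1+\frac2d}\,dx ,$$ where the right side is read as $0$ if $\psi=0$. -/

import Mathlib

open MeasureTheory
open scoped ENNReal ContDiff

noncomputable section

namespace LiebThirring

/-- The Euclidean space `ℝ^d`, with Lebesgue measure `volume`. -/
abbrev Rd (d : ℕ) : Type := EuclideanSpace ℝ (Fin d)

/-- The configuration space `ℝ^{dN} = (ℝ^d)^N` of `N` particles, with the product Lebesgue
measure `volume`. (Its norm only serves to speak of smooth compactly supported functions.) -/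
abbrev Config (d N : ℕ) : Type := Fin N → Rd d

/-- The standard basis `e_i` of `ℝ^d`. -/
def basisRd (d : ℕ) (i : Fin d) : Rd d := EuclideanSpace.single i 1

/-- The standard basis of `ℝ^{dN}`: the `i`-th coordinate direction of the `n`-th particle. -/
def basisConfig (d N : ℕ) (p : Fin N × Fin d) : Config d N := Pi.single p.1 (basisRd d p.2)

section Sobolev

variable {E : Type} [NormedAddCommGroup E] [NormedSpace ℝ E] [MeasureSpace E]
variable {ι : Type} [Fintype ι]

/-- `g` is the weak (distributional) derivative of `u` in the direction `v`:
`∫ (∂_v φ) u = - ∫ φ g` for all test functions `φ ∈ C_c^∞`. -/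
def HasWeakDeriv (v : E) (u g : E → ℂ) : Prop :=
  LocallyIntegrable u ∧ LocallyIntegrable g ∧
    ∀ φ : E → ℝ, ContDiff ℝ ∞ φ → HasCompactSupport φ →
      ∫ x, (fderiv ℝ φ x v) • u x = - ∫ x, φ x • g x

open Classical in
/-- The weak derivative of `u` in the direction `v` (unique almost everywhere when it exists,
and `0` when it does not exist). -/
def weakDeriv (v : E) (u : E → ℂ) : E → ℂ :=
  if h : ∃ g, HasWeakDeriv v u g then h.choose else 0

/-- `u ∈ H^1`: `u` and its weak derivatives in the coordinate directions `e i` are in `L^2`. -/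
def MemH1 (e : ι → E) (u : E → ℂ) : Prop :=
  MemLp u 2 ∧ ∀ i, ∃ g, HasWeakDeriv (e i) u g ∧ MemLp g 2

/-- `∫ |∇u|^2`, with `|∇u|^2 = ∑_i |∂_i u|^2` over the coordinate directions `e i`. -/
def kineticEnergy (e : ι → E) (u : E → ℂ) : ℝ≥0∞ :=
  ∫⁻ x, ∑ i, ‖weakDeriv (e i) u x‖ₑ ^ 2

end Sobolev

/-- `u_1, …, u_N` are orthonormal in `L^2(ℝ^d)`; used for functions that are in `L^2`. -/
def OrthonormalL2 {d N : ℕ} (u : Fin N → Rd d → ℂ) : Prop :=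
  ∀ m n, ∫ x, star (u m x) * u n x = if m = n then 1 else 0

/-- `K` is admissible in the Lieb-Thirring inequality: for all `N` and all
`u_1, …, u_N ∈ H^1(ℝ^d)` that are orthonormal in `L^2(ℝ^d)`,
`∑_n ∫ |∇u_n|^2 ≥ K ∫ (∑_n |u_n|^2)^{1+2/d}`. -/
def IsLTConstant (d : ℕ) (K : ℝ≥0∞) : Prop :=
  ∀ (N : ℕ) (u : Fin N → Rd d → ℂ),
    (∀ n, MemH1 (basisRd d) (u n)) → OrthonormalL2 u →
      K * ∫⁻ x, (∑ n, ‖u n x‖ₑ ^ 2) ^ (1 + 2 / (d : ℝ)) ≤ ∑ n, kineticEnergy (basisRd d) (u n)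

/-- The optimal constant `K_d` in the Lieb-Thirring inequality. -/
def optimalK (d : ℕ) : ℝ≥0∞ := sSup {K | IsLTConstant d K}

/-- The configuration in which particle `n` is at `x` and the other particles are at `y`. -/
def insertParticle {d N : ℕ} (n : Fin N) (x : Rd d) (y : {m : Fin N // m ≠ n} → Rd d) :
    Config d N :=
  fun m => if h : m = n then x else y ⟨m, h⟩

/-- The one-particle density `ρ_ψ(x)`: the sum over `n` of the integral of `|ψ|^2` over the
positions of all particles except the `n`-th one, which is at `x`. -/
def density {d N : ℕ} (ψ : Config d N → ℂ) (x : Rd d) : ℝ≥0∞ :=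
  ∑ n : Fin N, ∫⁻ y : {m : Fin N // m ≠ n} → Rd d, ‖ψ (insertParticle n x y)‖ₑ ^ 2

/-- `ψ(x_{σ(1)}, …, x_{σ(N)}) = sgn(σ) ψ(x_1, …, x_N)` for every permutation `σ`, for almost
every `x` (elements of `H^1` being defined up to null sets). -/
def Antisymmetric {d N : ℕ} (ψ : Config d N → ℂ) : Prop :=
  ∀ σ : Equiv.Perm (Fin N),
    ∀ᵐ x : Config d N, ψ (fun m => x (σ m)) = ((Equiv.Perm.sign σ : ℤ) : ℂ) * ψ x

end LiebThirring

end

set_option linter.unusedSectionVars false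

/-! The one-particle density operator `γ` of `ψ` carries the whole argument: its density is `ρ_ψ`,
`Tr(-Δ γ) = ∫|∇ψ|²`, and antisymmetry gives `0 ≤ γ ≤ ‖ψ‖²`. Hence `γ / ‖ψ‖²` has eigenvalues in
`[0,1]`, and the inequality for orthonormal systems extends to such operators because `t ↦
t^{1+2/d}` is convex (`IsLTConstant.weighted`). Undoing the normalisation costs the factor
`‖ψ‖^{4/d}`, and the constant is unchanged.

The operator is handled through `γ = ∑ |f⟩⟨f|`, where the `f` are the partial inner products of `ψ`
with orthonormal bases of `L²` of the other particles (`slice`). Parseval's identity gives density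
and kinetic energy. Finite subfamilies are diagonalised through their Gram matrix
(`IsLTConstant.of_bessel`), and monotone convergence recovers the full family.

The bound on `γ` is the Pauli principle: if `P_n` is `|u⟩⟨u|` in the variable of particle `n`, then
the vectors `P_n ψ` are mutually orthogonal, and Cauchy-Schwarz for `⟨∑ P_n ψ, ψ⟩` gives `⟨u, γ u⟩ ≤
‖ψ‖² ‖u‖²` (`sum_lintegral_annihilate_le`).

Positivity of `K_d` follows from Rumin's method: split frequencies at `|ξ|² = E`, bound the low part
pointwise by Bessel's inequality, and integrate the high part over `E` to recover the kinetic
energy. Finiteness follows from a single normalised bump function. -/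

namespace LiebThirring

/-! ### Weak derivatives and kinetic energy -/

section Sobolev

variable {E : Type} [NormedAddCommGroup E] [NormedSpace ℝ E] [MeasureSpace E]
variable {ι : Type} [Fintype ι]

variable [FiniteDimensional ℝ E] [BorelSpace E]

theorem HasWeakDeriv.ae_eq {v : E} {u g g' : E → ℂ} (h : HasWeakDeriv v u g)
    (h' : HasWeakDeriv v u g') : g =ᵐ[volume] g' := by
  refine ae_eq_of_integral_contDiff_smul_eq h.2.1 h'.2.1 fun φ hφ hc => ?_
  exact neg_injective ((h.2.2 φ hφ hc).symm.trans (h'.2.2 φ hφ hc))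

theorem HasWeakDeriv.weakDeriv_ae_eq {v : E} {u g : E → ℂ} (h : HasWeakDeriv v u g) :
    weakDeriv v u =ᵐ[volume] g := by
  have hex : ∃ g, HasWeakDeriv v u g := ⟨g, h⟩
  rw [weakDeriv, dif_pos hex]
  exact hex.choose_spec.ae_eq h

theorem HasWeakDeriv.aestronglyMeasurable {v : E} {u g : E → ℂ} (h : HasWeakDeriv v u g) :
    AEStronglyMeasurable g volume :=
  h.2.1.aestronglyMeasurable

/-- `weakDeriv` is an arbitrary choice; uniqueness almost everywhere lets any weak derivatives
replace it in later computations. -/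
theorem kineticEnergy_eq {e : ι → E} {u : E → ℂ} {g : ι → E → ℂ}
    (h : ∀ i, HasWeakDeriv (e i) u (g i)) :
    kineticEnergy e u = ∑ i, ∫⁻ x, ‖g i x‖ₑ ^ 2 := by
  have h1 : kineticEnergy e u = ∫⁻ x, ∑ i, ‖g i x‖ₑ ^ 2 := by
    refine lintegral_congr_ae ?_
    have := ae_all_iff.2 fun i => (h i).weakDeriv_ae_eq
    filter_upwards [this] with x hx
    simp only [hx]
  rw [h1, lintegral_finsetSum']
  intro i _
  exact ((h i).aestronglyMeasurable.enorm).pow_const 2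

theorem HasWeakDeriv.integrable_smul {u : E → ℂ} (hu : LocallyIntegrable u) {φ : E → ℝ}
    (hφ : Continuous φ) (hc : HasCompactSupport φ) : Integrable (fun x => φ x • u x) :=
  hu.integrable_smul_left_of_hasCompactSupport hφ hc

theorem HasWeakDeriv.integrable_fderiv_smul {u : E → ℂ} (hu : LocallyIntegrable u) {φ : E → ℝ}
    (hφ : ContDiff ℝ ∞ φ) (hc : HasCompactSupport φ) (v : E) :
    Integrable (fun x => (fderiv ℝ φ x v) • u x) := by
  refine hu.integrable_smul_left_of_hasCompactSupport ?_ (hc.fderiv_apply ℝ v)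
  exact (hφ.continuous_fderiv (by simp)).clm_apply continuous_const

theorem HasWeakDeriv.sum {κ : Type*} (s : Finset κ) (c : κ → ℂ) {v : E} {u g : κ → E → ℂ}
    (h : ∀ k, HasWeakDeriv v (u k) (g k)) :
    HasWeakDeriv v (fun x => ∑ k ∈ s, c k * u k x) (fun x => ∑ k ∈ s, c k * g k x) := by
  have hloc : ∀ w : κ → E → ℂ, (∀ k, LocallyIntegrable (w k)) →
      LocallyIntegrable (fun x => ∑ k ∈ s, c k * w k x) := fun w hw =>
    locallyIntegrable_finsetSum s fun k _ => by
      simpa [Pi.smul_def] using (hw k).smul (c k)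
  refine ⟨hloc u fun k => (h k).1, hloc g fun k => (h k).2.1, fun φ hφ hc => ?_⟩
  have key : ∀ (a : E → ℝ) (w : κ → E → ℂ), (∀ k, Integrable (fun x => a x • w k x)) →
      ∫ x, a x • ∑ k ∈ s, c k * w k x = ∑ k ∈ s, c k * ∫ x, a x • w k x := by
    intro a w hw
    have h1 : ∀ x, a x • ∑ k ∈ s, c k * w k x = ∑ k ∈ s, c k * (a x • w k x) := fun x => by
      simp only [Finset.smul_sum, mul_smul_comm]
    simp_rw [h1]
    rw [integral_finsetSum _ fun k _ => (hw k).const_mul (c k)]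
    simp_rw [integral_const_mul]
  rw [key _ u fun k => HasWeakDeriv.integrable_fderiv_smul (h k).1 hφ hc v,
    key _ g fun k => HasWeakDeriv.integrable_smul (h k).2.1 hφ.continuous hc,
    ← Finset.sum_neg_distrib]
  exact Finset.sum_congr rfl fun k _ => by rw [(h k).2.2 φ hφ hc, mul_neg]

end Sobolev

/-! ### Occupation numbers between 0 and 1 -/

/-- In coordinate `k`, `μ` lies on the segment between the values 1 and 0, with weights `μ k` and `1
- μ k`, and the sum is linear in `μ`. -/
theorem sum_mul_eq_update_one_add_update_zero {κ : Type*} [Fintype κ] [DecidableEq κ]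
    (μ c : κ → ℝ≥0∞) (k : κ) (hk : μ k ≤ 1) :
    ∑ j, μ j * c j = μ k * ∑ j, Function.update μ k 1 j * c j +
      (1 - μ k) * ∑ j, Function.update μ k 0 j * c j := by
  rw [Finset.mul_sum, Finset.mul_sum, ← Finset.sum_add_distrib]
  refine Finset.sum_congr rfl fun j _ => ?_
  by_cases hj : j = k
  · subst hj; simp
  · rw [Function.update_of_ne hj, Function.update_of_ne hj, ← add_mul,
      add_tsub_cancel_of_le hk, one_mul]

/-- The Lieb-Thirring inequality for an orthonormal system with occupation numbers in `[0,1]`. -/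
theorem IsLTConstant.weighted {d : ℕ} {K : ℝ≥0∞} (hK : IsLTConstant d K)
    {κ : Type*} [Fintype κ] [DecidableEq κ] {u : κ → Rd d → ℂ}
    (hu : ∀ k, MemH1 (basisRd d) (u k))
    (ho : ∀ k l, ∫ x, star (u k x) * u l x = if k = l then 1 else 0)
    (μ : κ → ℝ≥0∞) (hμ : ∀ k, μ k ≤ 1) :
    K * ∫⁻ x, (∑ k, μ k * ‖u k x‖ₑ ^ 2) ^ (1 + 2 / (d : ℝ)) ≤
      ∑ k, μ k * kineticEnergy (basisRd d) (u k) := by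
  have hp : (1 : ℝ) ≤ 1 + 2 / (d : ℝ) := by
    have : 0 ≤ 2 / (d : ℝ) := by positivity
    linarith
  have hmeas : ∀ ν : κ → ℝ≥0∞,
      AEMeasurable (fun x => (∑ k, ν k * ‖u k x‖ₑ ^ 2) ^ (1 + 2 / (d : ℝ))) := fun ν =>
    (Finset.aemeasurable_fun_sum _ fun k _ =>
      ((((hu k).1.aestronglyMeasurable).enorm).pow_const 2).const_mul _).pow_const _
  -- Induction on a set `s` outside which the weights are 0 or 1. For empty `s` the functions of
  -- weight 1 form an orthonormal system; the step averages the two cases `μ k = 1` and `μ k = 0`,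
  -- using convexity of the power on the left and linearity on the right.
  suffices H : ∀ s : Finset κ, ∀ μ : κ → ℝ≥0∞, (∀ k, μ k ≤ 1) →
      (∀ k, k ∉ s → μ k = 0 ∨ μ k = 1) →
      K * ∫⁻ x, (∑ k, μ k * ‖u k x‖ₑ ^ 2) ^ (1 + 2 / (d : ℝ)) ≤
        ∑ k, μ k * kineticEnergy (basisRd d) (u k) from
    H Finset.univ μ hμ fun k hk => absurd (Finset.mem_univ k) hk
  intro s
  induction s using Finset.induction_on with
  | empty =>
    intro μ _ h01
    classical
    let T := {k // μ k = 1}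
    let e : Fin (Fintype.card T) ≃ T := (Fintype.equivFin T).symm
    have hsum : ∀ c : κ → ℝ≥0∞, ∑ k, μ k * c k = ∑ n, c (e n) := fun c => by
      have h1 : ∀ k, μ k * c k = if μ k = 1 then c k else 0 := fun k => by
        rcases h01 k (by simp) with h | h <;> simp [h]
      rw [e.sum_comp (fun k : T => c k), Finset.sum_congr rfl fun k _ => h1 k,
        ← Finset.sum_filter]
      exact (Finset.sum_subtype _ (by simp) _)
    simp_rw [hsum]
    refine hK _ (fun n => u (e n)) (fun n => hu _) fun m n => ?_
    rw [ho]
    simp [Subtype.coe_inj]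
  | insert k s _ ih =>
    intro μ hμ h01
    have hup : ∀ a : ℝ≥0∞, a ≤ 1 → (a = 0 ∨ a = 1) →
        K * ∫⁻ x, (∑ j, Function.update μ k a j * ‖u j x‖ₑ ^ 2) ^ (1 + 2 / (d : ℝ)) ≤
        ∑ j, Function.update μ k a j * kineticEnergy (basisRd d) (u j) := fun a ha ha' => by
      refine ih _ (fun j => ?_) fun j hj => ?_
      · by_cases hjk : j = k
        · subst hjk; simpa using ha
        · simpa [Function.update_of_ne hjk] using hμ j
      · by_cases hjk : j = k
        · subst hjk; simpa using ha'
        · simpa [Function.update_of_ne hjk] using h01 j (by simp [hjk, hj])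
    have h1 := hup 1 le_rfl (Or.inr rfl)
    have h0 := hup 0 zero_le_one (Or.inl rfl)
    have hadd : μ k + (1 - μ k) = 1 := add_tsub_cancel_of_le (hμ k)
    calc K * ∫⁻ x, (∑ j, μ j * ‖u j x‖ₑ ^ 2) ^ (1 + 2 / (d : ℝ))
        ≤ K * ∫⁻ x, (μ k * (∑ j, Function.update μ k 1 j * ‖u j x‖ₑ ^ 2) ^ (1 + 2 / (d : ℝ)) +
          (1 - μ k) * (∑ j, Function.update μ k 0 j * ‖u j x‖ₑ ^ 2) ^ (1 + 2 / (d : ℝ))) := by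
          gcongr with x
          rw [sum_mul_eq_update_one_add_update_zero μ _ k (hμ k)]
          exact ENNReal.rpow_arith_mean_le_arith_mean2_rpow _ _ _ _ hadd hp
      _ = μ k * (K * ∫⁻ x, (∑ j, Function.update μ k 1 j * ‖u j x‖ₑ ^ 2) ^ (1 + 2 / (d : ℝ))) +
          (1 - μ k) *
            (K * ∫⁻ x, (∑ j, Function.update μ k 0 j * ‖u j x‖ₑ ^ 2) ^ (1 + 2 / (d : ℝ))) := by
          rw [lintegral_add_left' ((hmeas _).const_mul _), lintegral_const_mul'' _ (hmeas _),
            lintegral_const_mul'' _ (hmeas _), mul_add]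
          ring
      _ ≤ _ := by
          rw [sum_mul_eq_update_one_add_update_zero μ _ k (hμ k)]
          gcongr

/-! ### Diagonalising a finite family and normalising it -/

theorem sum_enorm_sq_eq_ofReal {κ : Type*} (s : Finset κ) (c : κ → ℂ) :
    ∑ k ∈ s, ‖c k‖ₑ ^ 2 = ENNReal.ofReal (∑ k ∈ s, ‖c k‖ ^ 2) := by
  rw [ENNReal.ofReal_sum_of_nonneg fun k _ => by positivity]
  refine Finset.sum_congr rfl fun k _ => ?_
  rw [ENNReal.ofReal_pow (norm_nonneg _), ofReal_norm]

/-- The left side is `c U U* c*`. This one identity preserves the density, the gradient density and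
the Bessel sums under rotation. -/
theorem sum_enorm_sq_unitary {κ : Type*} [Fintype κ] [DecidableEq κ] {U : Matrix κ κ ℂ}
    (hU : U * star U = 1) (c : κ → ℂ) :
    ∑ j, ‖∑ k, U k j * c k‖ₑ ^ 2 = ∑ k, ‖c k‖ₑ ^ 2 := by
  rw [sum_enorm_sq_eq_ofReal, sum_enorm_sq_eq_ofReal]
  congr 1
  have h : ∀ v : κ → ℂ, ((∑ k, ‖v k‖ ^ 2 : ℝ) : ℂ) = v ⬝ᵥ star v := fun v => by
    simp [dotProduct, Complex.mul_conj, Complex.normSq_eq_norm_sq]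
  have h2 : (fun j => ∑ k, U k j * c k) = Matrix.vecMul c U := by
    ext j; simp [Matrix.vecMul, dotProduct, mul_comm]
  apply Complex.ofReal_injective
  rw [h c]
  refine (h fun j => ∑ k, U k j * c k).trans ?_
  rw [h2, Matrix.star_vecMul, ← Matrix.dotProduct_mulVec, Matrix.mulVec_mulVec]
  change c ⬝ᵥ (U * star U).mulVec (star c) = _
  rw [hU, Matrix.one_mulVec]

theorem HasWeakDeriv.const_mul {E : Type} [NormedAddCommGroup E] [NormedSpace ℝ E]
    [MeasureSpace E] [FiniteDimensional ℝ E] [BorelSpace E] (c : ℂ) {v : E} {u g : E → ℂ}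
    (h : HasWeakDeriv v u g) : HasWeakDeriv v (fun x => c * u x) (fun x => c * g x) := by
  simpa using HasWeakDeriv.sum {()} (fun _ => c) (fun _ : Unit => h)

theorem MemH1.const_mul {d : ℕ} (c : ℂ) {u : Rd d → ℂ} (h : MemH1 (basisRd d) u) :
    MemH1 (basisRd d) (fun x => c * u x) :=
  ⟨h.1.const_mul c, fun i => by
    obtain ⟨g, hg, hg2⟩ := h.2 i
    exact ⟨_, hg.const_mul c, hg2.const_mul c⟩⟩

theorem kineticEnergy_const_mul {d : ℕ} (c : ℂ) {u : Rd d → ℂ} (h : MemH1 (basisRd d) u) :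
    kineticEnergy (basisRd d) (fun x => c * u x) = ‖c‖ₑ ^ 2 * kineticEnergy (basisRd d) u := by
  choose g hg hg2 using h.2
  rw [kineticEnergy_eq hg, kineticEnergy_eq fun i => (hg i).const_mul c, Finset.mul_sum]
  refine Finset.sum_congr rfl fun i _ => ?_
  simp_rw [enorm_mul, mul_pow]
  rw [lintegral_const_mul'']
  exact ((hg i).aestronglyMeasurable.enorm).pow_const 2

theorem integrable_star_mul {α : Type*} [MeasurableSpace α] {μ : Measure α} {f g : α → ℂ}
    (hf : MemLp f 2 μ) (hg : MemLp g 2 μ) : Integrable (fun x => star (f x) * g x) μ :=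
  MemLp.integrable_mul (p := 2) (q := 2) hf.star hg

theorem ofReal_integral_star_mul_self {α : Type*} [MeasurableSpace α] {μ : Measure α} {f : α → ℂ}
    (hf : MemLp f 2 μ) : ENNReal.ofReal (∫ x, star (f x) * f x ∂μ).re = ∫⁻ x, ‖f x‖ₑ ^ 2 ∂μ := by
  have h : ∀ x, star (f x) * f x = ((‖f x‖ ^ 2 : ℝ) : ℂ) := fun x => by
    simp [Complex.conj_mul']
  simp_rw [h]
  rw [integral_complex_ofReal, Complex.ofReal_re, ofReal_integral_eq_lintegral_ofReal
    ((memLp_two_iff_integrable_sq_norm hf.aestronglyMeasurable).1 hf) (Filter.Eventually.of_forall fun x => by positivity)]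
  refine lintegral_congr fun x => ?_
  rw [ENNReal.ofReal_pow (norm_nonneg _), ofReal_norm]

theorem integral_star_mul_self {α : Type*} [MeasurableSpace α] {μ : Measure α} {f : α → ℂ}
    (hf : MemLp f 2 μ) : ∫ x, star (f x) * f x ∂μ = ((∫⁻ x, ‖f x‖ₑ ^ 2 ∂μ).toReal : ℂ) := by
  have h : ∀ x, star (f x) * f x = ((‖f x‖ ^ 2 : ℝ) : ℂ) := fun x => by
    simp [Complex.conj_mul']
  rw [← ofReal_integral_star_mul_self hf]
  simp_rw [h]
  rw [integral_complex_ofReal, Complex.ofReal_re, ENNReal.toReal_ofReal]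
  exact integral_nonneg fun x => by positivity

/-- Unitary rotation of a finite family in `H^1` into an orthogonal one with the same density
and the same kinetic energy. -/
theorem exists_orthogonal_rotation {d : ℕ} {κ : Type*} [Fintype κ] [DecidableEq κ]
    {f : κ → Rd d → ℂ} (hf : ∀ k, MemH1 (basisRd d) (f k)) :
    ∃ (f' : κ → Rd d → ℂ), (∀ k, MemH1 (basisRd d) (f' k)) ∧
      (∀ x, ∑ k, ‖f' k x‖ₑ ^ 2 = ∑ k, ‖f k x‖ₑ ^ 2) ∧
      (∑ k, kineticEnergy (basisRd d) (f' k) = ∑ k, kineticEnergy (basisRd d) (f k)) ∧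
      (∀ k l, k ≠ l → ∫ x, star (f' k x) * f' l x = 0) ∧
      ∀ u, MemLp u 2 → ∑ k, ‖∫ x, star (u x) * f' k x‖ₑ ^ 2 =
        ∑ k, ‖∫ x, star (u x) * f k x‖ₑ ^ 2 := by
  -- The Gram matrix is Hermitian. Rotating by its eigenvector matrix `U` turns it into `U* G U`,
  -- which is diagonal.
  let G : Matrix κ κ ℂ := fun k l => ∫ x, star (f k x) * f l x
  have hG : G.IsHermitian := by
    ext k l
    change star (∫ x, star (f l x) * f k x) = ∫ x, star (f k x) * f l x
    change (starRingEnd ℂ) _ = _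
    rw [← integral_conj]
    congr 1
    ext x
    simp [mul_comm]
  let U : Matrix κ κ ℂ := hG.eigenvectorUnitary
  have hUU : U * star U = 1 := Unitary.coe_mul_star_self hG.eigenvectorUnitary
  have hUG : star U * G * U = Matrix.diagonal (RCLike.ofReal ∘ hG.eigenvalues) := by
    simpa using hG.conjStarAlgAut_star_eigenvectorUnitary
  choose g hg hg2 using fun k i => (hf k).2 i
  have hlin : ∀ u, MemLp u 2 → ∀ k, ∫ x, star (u x) * ∑ l, U l k * f l x =
      ∑ l, U l k * ∫ x, star (u x) * f l x := fun u hu k => by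
    have h1 : ∀ x, star (u x) * ∑ l, U l k * f l x = ∑ l, U l k * (star (u x) * f l x) :=
      fun x => by
        rw [Finset.mul_sum]
        exact Finset.sum_congr rfl fun l _ => by ring
    simp_rw [h1]
    rw [integral_finsetSum _ fun l _ => (integrable_star_mul hu (hf l).1).const_mul _]
    simp_rw [integral_const_mul]
  have hmem : ∀ k, MemLp (fun x => ∑ l, U l k * f l x) 2 := fun k =>
    memLp_finsetSum _ fun l _ => (hf l).1.const_mul _
  have hder : ∀ k i, HasWeakDeriv (basisRd d i) (fun x => ∑ l, U l k * f l x)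
      (fun x => ∑ l, U l k * g l i x) := fun k i =>
    HasWeakDeriv.sum _ (fun l => U l k) fun l => hg l i
  refine ⟨fun k x => ∑ l, U l k * f l x, fun k => ⟨hmem k, fun i => ⟨_, hder k i,
      memLp_finsetSum _ fun l _ => (hg2 l i).const_mul _⟩⟩,
    fun x => sum_enorm_sq_unitary hUU fun l => f l x, ?_, fun k l hkl => ?_, fun u hu => ?_⟩
  · simp_rw [fun k => kineticEnergy_eq (hder k), fun k => kineticEnergy_eq (hg k)]
    rw [Finset.sum_comm, Finset.sum_comm (s := Finset.univ (α := κ))]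
    refine Finset.sum_congr rfl fun i _ => ?_
    rw [← lintegral_finsetSum', ← lintegral_finsetSum']
    · exact lintegral_congr fun x => sum_enorm_sq_unitary hUU fun l => g l i x
    · exact fun k _ => ((hg k i).aestronglyMeasurable.enorm).pow_const 2
    · exact fun k _ => ((hder k i).aestronglyMeasurable.enorm).pow_const 2
  · have h1 : ∫ x, star (∑ m, U m k * f m x) * ∑ m, U m l * f m x = (star U * G * U) k l := by
      rw [hlin _ (hmem k), Matrix.mul_apply]
      refine Finset.sum_congr rfl fun m _ => ?_
      rw [mul_comm]
      congr 1
      have h2 : ∀ x, star (∑ m, U m k * f m x) * f m x =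
          ∑ n, star (U n k) * (star (f n x) * f m x) := fun x => by
        rw [star_sum, Finset.sum_mul]
        exact Finset.sum_congr rfl fun n _ => by rw [star_mul]; ring
      simp_rw [h2]
      rw [integral_finsetSum _ fun n _ => (integrable_star_mul (hf n).1 (hf m).1).const_mul _]
      simp_rw [integral_const_mul]
      rfl
    rw [h1, hUG, Matrix.diagonal_apply_ne _ hkl]
  · simp_rw [hlin u hu]
    exact sum_enorm_sq_unitary hUU fun l => ∫ x, star (u x) * f l x

/-- The Lieb-Thirring inequality for a finite family whose one-particle operator
`∑_k |f_k⟩⟨f_k|` is bounded by `C`. -/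
theorem IsLTConstant.of_bessel {d : ℕ} {K : ℝ≥0∞} (hK : IsLTConstant d K)
    {κ : Type*} [Fintype κ] {f : κ → Rd d → ℂ}
    (hf : ∀ k, MemH1 (basisRd d) (f k)) {C : ℝ≥0∞} (hC0 : C ≠ 0) (hC : C ≠ ⊤)
    (hb : ∀ u : Rd d → ℂ, MemLp u 2 →
      ∑ k, ‖∫ x, star (u x) * f k x‖ₑ ^ 2 ≤ C * ∫⁻ x, ‖u x‖ₑ ^ 2) :
    K * ∫⁻ x, (∑ k, ‖f k x‖ₑ ^ 2) ^ (1 + 2 / (d : ℝ)) ≤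
      C ^ (2 / (d : ℝ)) * ∑ k, kineticEnergy (basisRd d) (f k) := by
  classical
  obtain ⟨f', hf', hdens, hkin, horth, hbes⟩ := exists_orthogonal_rotation hf
  simp_rw [← hdens]
  rw [← hkin]
  let lam : κ → ℝ≥0∞ := fun k => ∫⁻ x, ‖f' k x‖ₑ ^ 2
  have hlam_top : ∀ k, lam k ≠ ⊤ := fun k => by
    have := ofReal_integral_star_mul_self (hf' k).1
    simp only [lam, ← this]
    exact ENNReal.ofReal_ne_top
  have hself : ∀ k, ∫ x, star (f' k x) * f' k x = ((lam k).toReal : ℂ) := fun k =>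
    integral_star_mul_self (hf' k).1
  -- Test the Bessel bound on `f' k` itself: the `k`-th term alone is `(lam k)²`, and the right side
  -- is `C * lam k`.
  have hlam_le : ∀ k, lam k ≤ C := fun k => by
    by_cases h0 : lam k = 0
    · simp [h0]
    have h1 := hb (f' k) (hf' k).1
    rw [← hbes _ (hf' k).1] at h1
    have h2 : lam k ^ 2 ≤ C * lam k := by
      refine le_trans ?_ h1
      refine le_trans (le_of_eq ?_) (Finset.single_le_sum (fun _ _ => zero_le) (Finset.mem_univ k))
      simp only [hself]
      congr 1
      rw [← ofReal_norm, Complex.norm_real, Real.norm_of_nonneg ENNReal.toReal_nonneg,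
        ENNReal.ofReal_toReal (hlam_top k)]
    rw [sq] at h2
    exact (ENNReal.mul_le_mul_iff_left h0 (hlam_top k)).1 h2
  -- Members with `lam k = 0` vanish almost everywhere and cannot be normalised; the others are
  -- multiplied by `lam^{-1/2}`.
  let J := {k // lam k ≠ 0}
  let c : J → ℂ := fun k => (((lam k).toReal.sqrt)⁻¹ : ℝ)
  have hpos : ∀ k : J, 0 < (lam k).toReal := fun k => ENNReal.toReal_pos k.2 (hlam_top k)
  have hcc : ∀ k : J, c k * c k * ((lam k).toReal : ℂ) = 1 := fun k => by
    simp only [c]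
    rw [← Complex.ofReal_mul, ← Complex.ofReal_mul, ← mul_inv, Real.mul_self_sqrt (hpos k).le,
      inv_mul_cancel₀ (hpos k).ne', Complex.ofReal_one]
  have hcn : ∀ k : J, ‖c k‖ₑ ^ 2 = (lam k)⁻¹ := fun k => by
    rw [← ofReal_norm, ← ENNReal.ofReal_pow (norm_nonneg _)]
    simp only [c]
    rw [Complex.norm_real, Real.norm_of_nonneg (by positivity), inv_pow,
      Real.sq_sqrt (hpos k).le, ENNReal.ofReal_inv_of_pos (hpos k),
      ENNReal.ofReal_toReal (hlam_top k)]
  -- With weights `lam k / C ≤ 1` the normalisation cancels, so each term becomes `C⁻¹` times the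
  -- original one. Homogeneity then leaves `C^{1+2/d} C⁻¹ = C^{2/d}`.
  have hwt := hK.weighted (u := fun (k : J) x => c k * f' k x)
    (fun k => (hf' k).const_mul _) (fun k l => ?_) (fun k => lam k / C)
    (fun k => ENNReal.div_le_of_le_mul (by simpa using hlam_le k))
  · have hcancel : ∀ (k : J) (a : ℝ≥0∞), lam k / C * ((lam k)⁻¹ * a) = C⁻¹ * a := fun k a => by
      rw [div_eq_mul_inv, mul_comm (lam k), mul_assoc, ← mul_assoc (lam k),
        ENNReal.mul_inv_cancel k.2 (hlam_top k), one_mul]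
    have hdens' : ∀ᵐ x, ∑ k : J, lam k / C * ‖c k * f' k x‖ₑ ^ 2 =
        C⁻¹ * ∑ k, ‖f' k x‖ₑ ^ 2 := by
      have hz : ∀ᵐ x, ∀ k, lam k = 0 → ‖f' k x‖ₑ ^ 2 = 0 := ae_all_iff.2 fun k => by
        by_cases h0 : lam k = 0
        · have := (lintegral_eq_zero_iff'
            (((hf' k).1.aestronglyMeasurable.enorm).pow_const 2)).1 h0
          filter_upwards [this] with x hx _ using hx
        · exact Filter.Eventually.of_forall fun x h => absurd h h0
      filter_upwards [hz] with x hx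
      simp_rw [enorm_mul, mul_pow, hcn, hcancel]
      rw [← Finset.mul_sum]
      congr 1
      rw [← Finset.sum_subtype (Finset.univ.filter fun k => lam k ≠ 0) (by simp)
        fun k => ‖f' k x‖ₑ ^ 2]
      refine Finset.sum_filter_of_ne fun k _ hk h0 => hk (hx k h0)
    rw [lintegral_congr_ae (hdens'.mono fun x hx => by
      simp only [hx] : _ =ᵐ[volume] fun x => (C⁻¹ * ∑ k, ‖f' k x‖ₑ ^ 2) ^ (1 + 2 / (d : ℝ)))]
      at hwt
    have hp0 : 0 ≤ 1 + 2 / (d : ℝ) := by positivity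
    simp_rw [ENNReal.mul_rpow_of_nonneg _ _ hp0, kineticEnergy_const_mul _ (hf' _), hcn, hcancel]
      at hwt
    rw [lintegral_const_mul' _ _ (by simp [hC0, hp0]), ← Finset.mul_sum] at hwt
    have hsub : ∑ k : J, kineticEnergy (basisRd d) (f' k) ≤
        ∑ k, kineticEnergy (basisRd d) (f' k) := by
      rw [← Finset.sum_subtype (Finset.univ.filter fun k => lam k ≠ 0) (by simp)
        fun k => kineticEnergy (basisRd d) (f' k)]
      exact Finset.sum_le_sum_of_subset (Finset.filter_subset _ _)
    have hCp : C ^ (1 + 2 / (d : ℝ)) * C⁻¹ ^ (1 + 2 / (d : ℝ)) = 1 := by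
      rw [← ENNReal.mul_rpow_of_nonneg _ _ hp0, ENNReal.mul_inv_cancel hC0 hC, ENNReal.one_rpow]
    calc K * ∫⁻ x, (∑ k, ‖f' k x‖ₑ ^ 2) ^ (1 + 2 / (d : ℝ))
        = C ^ (1 + 2 / (d : ℝ)) * (K * (C⁻¹ ^ (1 + 2 / (d : ℝ)) *
            ∫⁻ x, (∑ k, ‖f' k x‖ₑ ^ 2) ^ (1 + 2 / (d : ℝ)))) := by
          rw [mul_left_comm, ← mul_assoc (C ^ _), hCp, one_mul]
      _ ≤ C ^ (1 + 2 / (d : ℝ)) * (C⁻¹ * ∑ k : J, kineticEnergy (basisRd d) (f' k)) := by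
          gcongr
      _ = C ^ (2 / (d : ℝ)) * ∑ k : J, kineticEnergy (basisRd d) (f' k) := by
          rw [← mul_assoc, add_comm, ENNReal.rpow_add _ _ hC0 hC, ENNReal.rpow_one, mul_assoc,
            mul_assoc, ← mul_assoc C, ENNReal.mul_inv_cancel hC0 hC, one_mul]
      _ ≤ _ := by gcongr
  · have h1 : ∀ x, star (c k * f' k x) * (c l * f' l x) =
        c k * c l * (star (f' k x) * f' l x) := fun x => by
      have : star (c k) = c k := by simp [c]
      rw [star_mul, this]
      ring
    simp_rw [h1]
    rw [integral_const_mul]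
    by_cases hkl : k = l
    · subst hkl
      rw [hself, hcc, if_pos rfl]
    · rw [horth _ _ (fun h => hkl (Subtype.ext h)), mul_zero, if_neg hkl]

/-! ### Square-integrable functions on product spaces -/

section Product

variable {α β : Type*} [MeasurableSpace α] [MeasurableSpace β] {μ : Measure α} {ν : Measure β}
  [SFinite μ] [SFinite ν]

theorem eLpNorm_two_sq (f : α → ℂ) : eLpNorm f 2 μ ^ 2 = ∫⁻ x, ‖f x‖ₑ ^ 2 ∂μ := by
  have := eLpNorm_nnreal_pow_eq_lintegral (f := f) (μ := μ) (p := 2) (by simp)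
  simpa using this

theorem memLp_two_iff_lintegral {f : α → ℂ} :
    MemLp f 2 μ ↔ AEStronglyMeasurable f μ ∧ ∫⁻ x, ‖f x‖ₑ ^ 2 ∂μ < ⊤ := by
  rw [← eLpNorm_two_sq, MemLp, ENNReal.pow_lt_top_iff]
  simp

/-- Cauchy-Schwarz. -/
theorem enorm_integral_mul_sq_le {f g : α → ℂ} (hf : AEStronglyMeasurable f μ)
    (hg : AEStronglyMeasurable g μ) :
    ‖∫ x, f x * g x ∂μ‖ₑ ^ 2 ≤ (∫⁻ x, ‖f x‖ₑ ^ 2 ∂μ) * ∫⁻ x, ‖g x‖ₑ ^ 2 ∂μ := by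
  have h1 : ‖∫ x, f x * g x ∂μ‖ₑ ≤ ∫⁻ x, ‖f x‖ₑ * ‖g x‖ₑ ∂μ := by
    refine (enorm_integral_le_lintegral_enorm _).trans (le_of_eq ?_)
    simp_rw [enorm_mul]
  have h2 := ENNReal.lintegral_mul_le_Lp_mul_Lq μ Real.HolderConjugate.two_two hf.enorm hg.enorm
  have h3 : ∀ a : ℝ≥0∞, (a ^ (1 / 2 : ℝ)) ^ 2 = a := fun a => by
    rw [← ENNReal.rpow_natCast, ← ENNReal.rpow_mul]; norm_num
  calc _ ≤ _ := pow_le_pow_left₀ (by simp) (h1.trans h2) 2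
    _ = _ := by rw [mul_pow, h3, h3]; simp

theorem MemLp.ae_section {F : α × β → ℂ} (hF : MemLp F 2 (μ.prod ν)) :
    ∀ᵐ x ∂μ, MemLp (fun y => F (x, y)) 2 ν := by
  have h1 := (memLp_two_iff_lintegral.1 hF).2
  rw [lintegral_prod _ ((hF.aestronglyMeasurable.enorm).pow_const 2)] at h1
  have h2 := ae_lt_top' (((hF.aestronglyMeasurable.enorm).pow_const 2).lintegral_prod_right') h1.ne
  filter_upwards [h2, hF.aestronglyMeasurable.prodMk_left] with x hx hm
  exact memLp_two_iff_lintegral.2 ⟨hm, hx⟩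

theorem memLp_integral_mul_section {F : α × β → ℂ} (hF : MemLp F 2 (μ.prod ν)) {b : β → ℂ}
    (hb : MemLp b 2 ν) : MemLp (fun x => ∫ y, b y * F (x, y) ∂ν) 2 μ := by
  refine memLp_two_iff_lintegral.2 ⟨?_, ?_⟩
  · exact (hb.aestronglyMeasurable.comp_snd.mul hF.aestronglyMeasurable).integral_prod_right'
  · have h1 := (memLp_two_iff_lintegral.1 hF).2
    rw [lintegral_prod _ ((hF.aestronglyMeasurable.enorm).pow_const 2)] at h1
    calc ∫⁻ x, ‖∫ y, b y * F (x, y) ∂ν‖ₑ ^ 2 ∂μ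
        ≤ ∫⁻ x, (∫⁻ y, ‖b y‖ₑ ^ 2 ∂ν) * ∫⁻ y, ‖F (x, y)‖ₑ ^ 2 ∂ν ∂μ := by
          refine lintegral_mono_ae ?_
          filter_upwards [hF.aestronglyMeasurable.prodMk_left] with x hx
          exact enorm_integral_mul_sq_le hb.aestronglyMeasurable hx
      _ = (∫⁻ y, ‖b y‖ₑ ^ 2 ∂ν) * ∫⁻ x, ∫⁻ y, ‖F (x, y)‖ₑ ^ 2 ∂ν ∂μ :=
          lintegral_const_mul' _ _ (memLp_two_iff_lintegral.1 hb).2.ne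
      _ < ⊤ := ENNReal.mul_lt_top (memLp_two_iff_lintegral.1 hb).2 h1

theorem memLp_swap {F : α × β → ℂ} (hF : MemLp F 2 (μ.prod ν)) :
    MemLp (F ∘ Prod.swap) 2 (ν.prod μ) :=
  hF.comp_measurePreserving Measure.measurePreserving_swap

theorem memLp_tensor {a : α → ℂ} {b : β → ℂ} (ha : MemLp a 2 μ) (hb : MemLp b 2 ν) :
    MemLp (fun z : α × β => a z.1 * b z.2) 2 (μ.prod ν) := by
  refine memLp_two_iff_lintegral.2 ⟨ha.aestronglyMeasurable.comp_fst.mul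
    hb.aestronglyMeasurable.comp_snd, ?_⟩
  simp_rw [enorm_mul, mul_pow]
  rw [lintegral_prod_mul ((ha.aestronglyMeasurable.enorm).pow_const 2)
    ((hb.aestronglyMeasurable.enorm).pow_const 2)]
  exact ENNReal.mul_lt_top (memLp_two_iff_lintegral.1 ha).2 (memLp_two_iff_lintegral.1 hb).2

theorem integrable_tensor_mul {F : α × β → ℂ} (hF : MemLp F 2 (μ.prod ν)) {a : α → ℂ} {b : β → ℂ}
    (ha : MemLp a 2 μ) (hb : MemLp b 2 ν) :
    Integrable (fun z : α × β => a z.1 * b z.2 * F z) (μ.prod ν) :=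
  MemLp.integrable_mul (p := 2) (q := 2) (memLp_tensor ha hb) hF

theorem integral_tensor_mul {F : α × β → ℂ} (hF : MemLp F 2 (μ.prod ν)) {a : α → ℂ} {b : β → ℂ}
    (ha : MemLp a 2 μ) (hb : MemLp b 2 ν) :
    ∫ z, a z.1 * b z.2 * F z ∂(μ.prod ν) = ∫ x, a x * ∫ y, b y * F (x, y) ∂ν ∂μ := by
  rw [integral_prod _ (integrable_tensor_mul hF ha hb)]
  simp_rw [mul_assoc, integral_const_mul]

theorem integral_tensor_mul_symm {F : α × β → ℂ} (hF : MemLp F 2 (μ.prod ν)) {a : α → ℂ}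
    {b : β → ℂ} (ha : MemLp a 2 μ) (hb : MemLp b 2 ν) :
    ∫ z, a z.1 * b z.2 * F z ∂(μ.prod ν) = ∫ y, b y * ∫ x, a x * F (x, y) ∂μ ∂ν := by
  rw [integral_prod_symm _ (integrable_tensor_mul hF ha hb)]
  simp_rw [mul_comm (a _) (b _), mul_assoc, integral_const_mul]

end Product

/-! ### Separating one particle from the others -/

section InsertAt

variable {d : ℕ} {ι : Type*} [Fintype ι] [DecidableEq ι]

/-- The function on `ι` with value `x` at `n` and given by `y` elsewhere. -/
def insertAt (n : ι) (x : Rd d) (y : {m : ι // m ≠ n} → Rd d) : ι → Rd d :=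
  fun m => if h : m = n then x else y ⟨m, h⟩

/-- The index type is arbitrary so that two particles can be separated in succession, the second
from the subtype of those that remain. -/
theorem measurePreserving_insertAt (n : ι) :
    MeasurePreserving (fun z : Rd d × ({m : ι // m ≠ n} → Rd d) => insertAt n z.1 z.2)
      (volume.prod volume) volume := by
  let _ : Fintype {m : ι // m = n} := Subtype.fintype fun m => m = n
  have h1 := (volume_preserving_piUnique fun _ : {m : ι // m = n} => Rd d).symm
  have h2 := h1.prod (MeasurePreserving.id (volume : Measure ({m : ι // m ≠ n} → Rd d)))
  have h3 : MeasurePreserving _ (volume.prod volume) _ :=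
    (volume_preserving_piEquivPiSubtypeProd (fun _ : ι => Rd d) (fun m => m = n)).symm
  exact h3.comp h2

theorem measurableEmbedding_insertAt (n : ι) :
    MeasurableEmbedding
      (fun z : Rd d × ({m : ι // m ≠ n} → Rd d) => insertAt n z.1 z.2) := by
  let e := (MeasurableEquiv.prodCongr (MeasurableEquiv.piUnique fun _ : {m : ι // m = n} => Rd d).symm
    (MeasurableEquiv.refl ({m : ι // m ≠ n} → Rd d))).trans
    (MeasurableEquiv.piEquivPiSubtypeProd (fun _ : ι => Rd d) (fun m => m = n)).symm
  exact e.measurableEmbedding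

end InsertAt

section Insert

variable {d N : ℕ}

/-- Configurations of all particles but the `n`-th. -/
abbrev Others (d : ℕ) {N : ℕ} (n : Fin N) : Type := {m : Fin N // m ≠ n} → Rd d

/-- The positions of all particles but the `n`-th. -/
def others (n : Fin N) (c : Config d N) : Others d n := fun m => c m

theorem insertParticle_self (n : Fin N) (x : Rd d) (y : Others d n) :
    insertParticle n x y n = x := by simp [insertParticle]

theorem insertParticle_of_ne (n : Fin N) (x : Rd d) (y : Others d n) {m : Fin N} (h : m ≠ n) :
    insertParticle n x y m = y ⟨m, h⟩ := by simp [insertParticle, h]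

theorem others_insertParticle (n : Fin N) (x : Rd d) (y : Others d n) :
    others n (insertParticle n x y) = y :=
  funext fun m => insertParticle_of_ne n x y m.2

theorem insertParticle_others (n : Fin N) (x : Rd d) (c : Config d N) :
    insertParticle n x (others n c) = Function.update c n x := by
  ext1 m
  by_cases h : m = n
  · subst h; simp [insertParticle]
  · simp [insertParticle, others, h]

theorem measurePreserving_insertParticle (n : Fin N) :
    MeasurePreserving (fun z : Rd d × Others d n => insertParticle n z.1 z.2)
      (volume.prod volume) volume :=
  measurePreserving_insertAt n

theorem measurableEmbedding_insertParticle (n : Fin N) :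
    MeasurableEmbedding (fun z : Rd d × Others d n => insertParticle n z.1 z.2) :=
  measurableEmbedding_insertAt n

theorem integral_insertParticle (n : Fin N) (F : Config d N → ℂ) :
    ∫ z : Rd d × Others d n, F (insertParticle n z.1 z.2) ∂(volume.prod volume) = ∫ c, F c :=
  (measurePreserving_insertParticle n).integral_comp (measurableEmbedding_insertParticle n) F

theorem lintegral_insertParticle (n : Fin N) (F : Config d N → ℝ≥0∞) :
    ∫⁻ z : Rd d × Others d n, F (insertParticle n z.1 z.2) ∂(volume.prod volume) = ∫⁻ c, F c :=
  (measurePreserving_insertParticle n).lintegral_comp_emb (measurableEmbedding_insertParticle n) F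

theorem memLp_insertParticle {F : Config d N → ℂ} (hF : MemLp F 2) (n : Fin N) :
    MemLp (fun z : Rd d × Others d n => F (insertParticle n z.1 z.2)) 2 (volume.prod volume) :=
  hF.comp_measurePreserving (measurePreserving_insertParticle n)

theorem continuous_insertParticle (n : Fin N) :
    Continuous (fun z : Rd d × Others d n => insertParticle n z.1 z.2) := by
  refine continuous_pi fun m => ?_
  by_cases h : m = n
  · subst h; simpa [insertParticle] using continuous_fst
  · simp only [insertParticle, h, dif_neg, not_false_eq_true]
    fun_prop

theorem contDiff_tensor {n : Fin N} {φ : Rd d → ℝ} {χ : Others d n → ℝ} (hφ : ContDiff ℝ ∞ φ)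
    (hχ : ContDiff ℝ ∞ χ) : ContDiff ℝ ∞ fun c : Config d N => φ (c n) * χ (others n c) := by
  refine (hφ.comp (contDiff_apply ℝ (Rd d) n)).mul (hχ.comp ?_)
  exact contDiff_pi.2 fun m => contDiff_apply ℝ (Rd d) m.1

theorem hasCompactSupport_tensor {n : Fin N} {φ : Rd d → ℝ} {χ : Others d n → ℝ}
    (hφ : HasCompactSupport φ) (hχ : HasCompactSupport χ) :
    HasCompactSupport fun c : Config d N => φ (c n) * χ (others n c) := by
  refine HasCompactSupport.intro ((hφ.isCompact.prod hχ.isCompact).image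
    (continuous_insertParticle n)) fun c hc => ?_
  by_contra hne
  refine hc ⟨(c n, others n c), ⟨subset_tsupport _ (left_ne_zero_of_mul hne),
    subset_tsupport _ (right_ne_zero_of_mul hne)⟩, ?_⟩
  simp [insertParticle_others]

theorem fderiv_tensor {n : Fin N} {φ : Rd d → ℝ} {χ : Others d n → ℝ} (hφ : ContDiff ℝ ∞ φ)
    (hχ : ContDiff ℝ ∞ χ) (i : Fin d) (c : Config d N) :
    fderiv ℝ (fun c : Config d N => φ (c n) * χ (others n c)) c (basisConfig d N (n, i)) =
      fderiv ℝ φ (c n) (basisRd d i) * χ (others n c) := by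
  let P : Config d N →L[ℝ] Rd d := ContinuousLinearMap.proj n
  let R : Config d N →L[ℝ] Others d n := ContinuousLinearMap.pi fun m => ContinuousLinearMap.proj m.1
  have h1 : HasFDerivAt (fun c : Config d N => φ (c n)) ((fderiv ℝ φ (c n)).comp P) c :=
    ((hφ.differentiable (by simp)) (c n)).hasFDerivAt.comp c P.hasFDerivAt
  have h2 : HasFDerivAt (fun c : Config d N => χ (others n c))
      ((fderiv ℝ χ (others n c)).comp R) c :=
    ((hχ.differentiable (by simp)) (others n c)).hasFDerivAt.comp c R.hasFDerivAt
  have hP : P (basisConfig d N (n, i)) = basisRd d i := by simp [P, basisConfig]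
  have hR : R (basisConfig d N (n, i)) = 0 := by
    ext1 m
    simp [R, basisConfig, Pi.single_eq_of_ne m.2]
  have h3 : HasFDerivAt (fun c : Config d N => φ (c n) * χ (others n c)) _ c := h1.mul h2
  rw [h3.fderiv]
  simp only [add_apply, smul_apply, ContinuousLinearMap.comp_apply, hP, hR, map_zero, smul_eq_mul]
  ring

/-- The pairing of `F` with a function `w` of all particles but the `n`-th. -/
noncomputable def slice (n : Fin N) (F : Config d N → ℂ) (w : Others d n → ℂ) (x : Rd d) : ℂ :=
  ∫ y, star (w y) * F (insertParticle n x y)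

theorem memLp_slice {n : Fin N} {F : Config d N → ℂ} (hF : MemLp F 2) {w : Others d n → ℂ}
    (hw : MemLp w 2) : MemLp (slice n F w) 2 :=
  memLp_integral_mul_section (memLp_insertParticle hF n) hw.star

theorem memLp_two_of_continuous_hasCompactSupport {E : Type*} [NormedAddCommGroup E]
    [MeasurableSpace E] [OpensMeasurableSpace E] [SecondCountableTopologyEither E ℝ]
    {μ : Measure E} [IsFiniteMeasureOnCompacts μ] {φ : E → ℝ} (hφ : Continuous φ)
    (hc : HasCompactSupport φ) : MemLp (fun x => (φ x : ℂ)) 2 μ := by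
  have := hφ.memLp_of_hasCompactSupport (p := 2) (μ := μ) hc
  exact this.ofReal

/-- Since `w` is only in `L²`, it cannot enter a test function. Testing with products `φ ⊗ χ` and
varying `χ` gives the integration by parts formula in `x` for almost every `y`; it is then
integrated against `star w`. -/
theorem hasWeakDeriv_slice {n : Fin N} {i : Fin d} {F G : Config d N → ℂ}
    (hF : MemLp F 2) (hG : MemLp G 2) (h : HasWeakDeriv (basisConfig d N (n, i)) F G)
    {w : Others d n → ℂ} (hw : MemLp w 2) :
    HasWeakDeriv (basisRd d i) (slice n F w) (slice n G w) := by
  refine ⟨(memLp_slice hF hw).locallyIntegrable (by norm_num),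
    (memLp_slice hG hw).locallyIntegrable (by norm_num), fun φ hφ hc => ?_⟩
  have hF' := memLp_insertParticle hF n
  have hG' := memLp_insertParticle hG n
  have ha : MemLp (fun x => (φ x : ℂ)) 2 :=
    memLp_two_of_continuous_hasCompactSupport hφ.continuous hc
  have ha' : MemLp (fun x => (fderiv ℝ φ x (basisRd d i) : ℂ)) 2 :=
    memLp_two_of_continuous_hasCompactSupport
      ((hφ.continuous_fderiv (by simp)).clm_apply continuous_const) (hc.fderiv_apply ℝ _)
  have hH1 := memLp_integral_mul_section (memLp_swap hF') ha'
  have hH2 := memLp_integral_mul_section (memLp_swap hG') ha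
  simp only [Function.comp_apply, Prod.fst_swap, Prod.snd_swap] at hH1 hH2
  have hH0 : ∀ᵐ y : Others d n, (∫ x, (fderiv ℝ φ x (basisRd d i) : ℂ) *
      F (insertParticle n x y)) + ∫ x, (φ x : ℂ) * G (insertParticle n x y) = 0 := by
    refine ae_eq_zero_of_integral_contDiff_smul_eq_zero
      ((hH1.add hH2).locallyIntegrable (by norm_num)) fun χ hχ hχc => ?_
    have hb : MemLp (fun y => (χ y : ℂ)) 2 :=
      memLp_two_of_continuous_hasCompactSupport hχ.continuous hχc
    have h1 := h.2.2 _ (contDiff_tensor hφ hχ) (hasCompactSupport_tensor hc hχc)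
    rw [← integral_insertParticle n, ← integral_insertParticle n] at h1
    simp only [fderiv_tensor hφ hχ, insertParticle_self, others_insertParticle, Complex.real_smul,
      Complex.ofReal_mul] at h1
    rw [integral_tensor_mul_symm hF' ha' hb, integral_tensor_mul_symm hG' ha hb] at h1
    have i1 : Integrable fun y => (χ y : ℂ) *
      ∫ x, (fderiv ℝ φ x (basisRd d i) : ℂ) * F (insertParticle n x y) := hb.integrable_mul hH1
    have i2 : Integrable fun y => (χ y : ℂ) * ∫ x, (φ x : ℂ) * G (insertParticle n x y) :=
      hb.integrable_mul hH2
    simp only [Complex.real_smul, mul_add]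
    rw [integral_add i1 i2, h1, neg_add_cancel]
  have hw' : MemLp (fun y => star (w y)) 2 := hw.star
  simp only [Complex.real_smul, slice]
  rw [← integral_tensor_mul hF' ha' hw', ← integral_tensor_mul hG' ha hw',
    integral_tensor_mul_symm hF' ha' hw', integral_tensor_mul_symm hG' ha hw',
    ← integral_neg]
  refine integral_congr_ae ?_
  filter_upwards [hH0] with y hy
  rw [eq_neg_of_add_eq_zero_left hy, mul_neg]

theorem memH1_slice {n : Fin N} {F : Config d N → ℂ} (hF : MemH1 (basisConfig d N) F)
    {w : Others d n → ℂ} (hw : MemLp w 2) : MemH1 (basisRd d) (slice n F w) :=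
  ⟨memLp_slice hF.1 hw, fun i => by
    obtain ⟨G, hG, hG2⟩ := hF.2 (n, i)
    exact ⟨_, hasWeakDeriv_slice hF.1 hG2 hG hw, memLp_slice hG2 hw⟩⟩

end Insert

/-! ### The Pauli bound on the one-particle operator -/

/-- Exchanging the two variables changes the sign of `a(x) a(t) W(x,t)`, so the integral equals its
negative. -/
theorem integral_tensor_antisymm_eq_zero {α : Type*} [MeasurableSpace α] {μ : Measure α}
    [SFinite μ] {W : α × α → ℂ} (hW : MemLp W 2 (μ.prod μ))
    (hanti : ∀ᵐ z ∂(μ.prod μ), W z.swap = -W z) {a : α → ℂ} (ha : MemLp a 2 μ) :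
    ∫ x, a x * ∫ t, a t * W (x, t) ∂μ ∂μ = 0 := by
  rw [← integral_tensor_mul hW ha ha]
  have h1 := integral_prod_swap (μ := μ) (ν := μ) (fun z : α × α => a z.1 * a z.2 * W z)
  have h2 : ∫ z : α × α, a z.swap.1 * a z.swap.2 * W z.swap ∂(μ.prod μ) =
      -∫ z : α × α, a z.1 * a z.2 * W z ∂(μ.prod μ) := by
    rw [← integral_neg]
    refine integral_congr_ae ?_
    filter_upwards [hanti] with z hz
    simp only [hz, Prod.fst_swap, Prod.snd_swap]
    ring
  exact self_eq_neg.1 (h1.symm.trans h2)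

variable {d N : ℕ}

/-- The partial inner product of `u` with `F` in the variable of the `n`-th particle. -/
noncomputable def annihilate (n : Fin N) (u : Rd d → ℂ) (F : Config d N → ℂ) (y : Others d n) : ℂ :=
  ∫ x, star (u x) * F (insertParticle n x y)

theorem memLp_annihilate {n : Fin N} {u : Rd d → ℂ} (hu : MemLp u 2) {F : Config d N → ℂ}
    (hF : MemLp F 2) : MemLp (annihilate n u F) 2 := by
  have hu' : MemLp (fun x => star (u x)) 2 := hu.star
  exact memLp_integral_mul_section (memLp_swap (memLp_insertParticle hF n)) hu'

/-- `|u⟩⟨u|` acting on the variable of the `n`-th particle. -/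
noncomputable def projectOn (n : Fin N) (u : Rd d → ℂ) (F : Config d N → ℂ) (c : Config d N) : ℂ :=
  u (c n) * annihilate n u F (others n c)

theorem projectOn_insertParticle (n : Fin N) (u : Rd d → ℂ) (F : Config d N → ℂ) (x : Rd d)
    (y : Others d n) : projectOn n u F (insertParticle n x y) = u x * annihilate n u F y := by
  rw [projectOn, insertParticle_self, others_insertParticle]

theorem memLp_projectOn {n : Fin N} {u : Rd d → ℂ} (hu : MemLp u 2) {F : Config d N → ℂ}
    (hF : MemLp F 2) : MemLp (projectOn n u F) 2 := by
  have h := memLp_tensor hu (memLp_annihilate (n := n) hu hF)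
  rw [← (measurePreserving_insertParticle n).map_eq,
    (measurableEmbedding_insertParticle n).memLp_map_measure_iff]
  simpa only [Function.comp_def, projectOn_insertParticle] using h

/-- With `a_n` for `annihilate n u`, `projectOn n u` is `a_n* a_n`, and the adjoint moves to the
other factor. -/
theorem integral_star_projectOn_mul {n : Fin N} {u : Rd d → ℂ} (hu : MemLp u 2)
    {F G : Config d N → ℂ} (hF : MemLp F 2) (hG : MemLp G 2) :
    ∫ c, star (projectOn n u F c) * G c =
      ∫ y, star (annihilate n u F y) * annihilate n u G y := by
  rw [← integral_insertParticle n]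
  have hu' : MemLp (fun x => star (u x)) 2 := hu.star
  have ha' : MemLp (fun y => star (annihilate n u F y)) 2 := (memLp_annihilate hu hF).star
  have h := integral_tensor_mul_symm (memLp_insertParticle hG n) hu' ha'
  refine Eq.trans (integral_congr_ae (Filter.Eventually.of_forall fun z => ?_)) h
  simp only [projectOn_insertParticle, star_mul]
  ring

theorem lintegral_projectOn {n : Fin N} {u : Rd d → ℂ} (hu : MemLp u 2)
    {F : Config d N → ℂ} (hF : MemLp F 2) :
    ∫⁻ c, ‖projectOn n u F c‖ₑ ^ 2 = (∫⁻ x, ‖u x‖ₑ ^ 2) * ∫⁻ y, ‖annihilate n u F y‖ₑ ^ 2 := by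
  rw [← lintegral_insertParticle n]
  simp only [projectOn_insertParticle, enorm_mul, mul_pow]
  exact lintegral_prod_mul ((hu.aestronglyMeasurable.enorm).pow_const 2)
    (((memLp_annihilate hu hF).aestronglyMeasurable.enorm).pow_const 2)

/-- Pauli principle: no two particles are both in the state `u`. With the remaining positions
frozen, the expression is `u(x_m)` times the pairing of `ψ` with `star u ⊗ star u` in the variables
`n` and `m`, which vanishes by antisymmetry. -/
theorem annihilate_projectOn_ae_eq_zero {ψ : Config d N → ℂ} (hψ : MemLp ψ 2)
    (hanti : Antisymmetric ψ) {u : Rd d → ℂ} (hu : MemLp u 2) {n m : Fin N} (hnm : m ≠ n) :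
    ∀ᵐ y, annihilate n u (projectOn m u ψ) y = 0 := by
  let m' : {k : Fin N // k ≠ n} := ⟨m, hnm⟩
  have hmp2 := measurePreserving_insertAt (d := d) m'
  have hmp3 := (measurePreserving_insertParticle (d := d) n).comp
    ((MeasurePreserving.id volume).prod hmp2)
  have hmp : MeasurePreserving
      (fun q : (Rd d × Rd d) × ({k : {k : Fin N // k ≠ n} // k ≠ m'} → Rd d) =>
        insertParticle n q.1.1 (insertAt m' q.1.2 q.2))
      ((volume.prod volume).prod volume) volume :=
    hmp3.comp (measurePreserving_prodAssoc volume volume volume)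
  have hsec := MemLp.ae_section (memLp_swap (hψ.comp_measurePreserving hmp))
  have hswap : ∀ᵐ q ∂((volume : Measure (Rd d)).prod (volume : Measure (Rd d))).prod
        (volume : Measure ({k : {k : Fin N // k ≠ n} // k ≠ m'} → Rd d)),
      ψ (insertParticle n q.1.2 (insertAt m' q.1.1 q.2)) =
        -ψ (insertParticle n q.1.1 (insertAt m' q.1.2 q.2)) := by
    filter_upwards [hmp.quasiMeasurePreserving.ae (hanti (Equiv.swap n m))] with q hq
    rw [Equiv.Perm.sign_swap hnm.symm] at hq
    have : (fun k => insertParticle n q.1.1 (insertAt m' q.1.2 q.2) (Equiv.swap n m k)) =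
        insertParticle n q.1.2 (insertAt m' q.1.1 q.2) := by
      ext1 k
      by_cases hk : k = n
      · subst hk
        simp [insertParticle, insertAt, hnm, m']
      · by_cases hk' : k = m
        · subst hk'
          simp [insertParticle, insertAt, hnm, m']
        · rw [Equiv.swap_apply_of_ne_of_ne hk hk']
          simp [insertParticle, insertAt, hk, hk', m']
    rw [this] at hq
    simpa using hq
  have hswap' := Measure.ae_ae_of_ae_prod (Measure.measurePreserving_swap.quasiMeasurePreserving.ae hswap)
  rw [← hmp2.map_eq, (measurableEmbedding_insertAt m').ae_map_iff]
  filter_upwards [Measure.quasiMeasurePreserving_snd.ae (hsec.and hswap')] with q hq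
  have hu' : MemLp (fun x => star (u x)) 2 := hu.star
  have hJ := integral_tensor_antisymm_eq_zero hq.1 hq.2 hu'
  -- The position `q.1` of particle `m` survives only in the factor `u q.1`; inside `ψ` it is
  -- replaced by the integration variable `t`.
  have hval : ∀ x, star (u x) * projectOn m u ψ (insertParticle n x (insertAt m' q.1 q.2)) =
      u q.1 * (star (u x) *
        ∫ t, star (u t) * ψ (insertParticle n x (insertAt m' t q.2))) := fun x => by
    have h1 : insertParticle n x (insertAt m' q.1 q.2) m = q.1 := by
      simp [insertParticle, insertAt, hnm, m']
    have h2 : ∀ t, insertParticle m t (others m (insertParticle n x (insertAt m' q.1 q.2))) =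
        insertParticle n x (insertAt m' t q.2) := fun t => by
      rw [insertParticle_others]
      ext1 k
      by_cases hk : k = m
      · subst hk
        simp [insertParticle, insertAt, hnm, m']
      · rw [Function.update_of_ne hk]
        by_cases hk' : k = n
        · subst hk'; simp [insertParticle]
        · simp [insertParticle, insertAt, hk, hk', m']
    rw [projectOn, h1, annihilate]
    simp_rw [h2]
    ring
  rw [annihilate]
  simp_rw [hval]
  rw [integral_const_mul]
  have : (∫ x, star (u x) * ∫ t, star (u t) * ψ (insertParticle n x (insertAt m' t q.2))) = 0 := hJ
  rw [this, mul_zero]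

/-- The one-particle operator of an antisymmetric `ψ` is bounded by `‖ψ‖²`. -/
theorem sum_lintegral_annihilate_le {ψ : Config d N → ℂ} (hψ : MemLp ψ 2)
    (hanti : Antisymmetric ψ) {u : Rd d → ℂ} (hu : MemLp u 2) :
    ∑ n, ∫⁻ y, ‖annihilate n u ψ y‖ₑ ^ 2 ≤ (∫⁻ c, ‖ψ c‖ₑ ^ 2) * ∫⁻ x, ‖u x‖ₑ ^ 2 := by
  -- Let `S = ∑ P n`, `A = ∑ b n` and `U = ‖u‖²`. Then `⟨S, ψ⟩ = A`, and `‖S‖² = U A` because the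
  -- cross terms vanish. Cauchy-Schwarz gives `A² ≤ U A ‖ψ‖²`, and one factor `A` cancels.
  let P : Fin N → Config d N → ℂ := fun n => projectOn n u ψ
  have hP : ∀ n, MemLp (P n) 2 := fun n => memLp_projectOn hu hψ
  let b : Fin N → ℝ≥0∞ := fun n => ∫⁻ y, ‖annihilate n u ψ y‖ₑ ^ 2
  let U : ℝ≥0∞ := ∫⁻ x, ‖u x‖ₑ ^ 2
  have hb : ∀ n, b n ≠ ⊤ := fun n => (memLp_two_iff_lintegral.1 (memLp_annihilate hu hψ)).2.ne
  have hU : U ≠ ⊤ := (memLp_two_iff_lintegral.1 hu).2.ne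
  have h1 : ∀ n, ∫ c, star (P n c) * ψ c = ((b n).toReal : ℂ) := fun n => by
    rw [integral_star_projectOn_mul hu hψ hψ, integral_star_mul_self (memLp_annihilate hu hψ)]
  have h2 : ∀ n m, ∫ c, star (P n c) * P m c =
      if n = m then ((U * b n).toReal : ℂ) else 0 := fun n m => by
    split_ifs with h
    · subst h
      rw [integral_star_mul_self (hP n), lintegral_projectOn hu hψ]
    · rw [integral_star_projectOn_mul hu hψ (hP m)]
      refine integral_eq_zero_of_ae ?_
      filter_upwards [annihilate_projectOn_ae_eq_zero hψ hanti hu (Ne.symm h)] with y hy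
      simp [P, hy]
  let S : Config d N → ℂ := fun c => ∑ n, P n c
  have hS : MemLp S 2 := memLp_finsetSum _ fun n _ => hP n
  have hsum : ∀ G : Config d N → ℂ, MemLp G 2 →
      ∫ c, star (S c) * G c = ∑ n, ∫ c, star (P n c) * G c := fun G hG => by
    simp only [S, star_sum, Finset.sum_mul]
    exact integral_finsetSum _ fun n _ => integrable_star_mul (hP n) hG
  let A : ℝ≥0∞ := ∑ n, b n
  have hA : A ≠ ⊤ := (ENNReal.sum_lt_top.2 fun n _ => (hb n).lt_top).ne
  have hSψ : ∫ c, star (S c) * ψ c = (A.toReal : ℂ) := by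
    rw [hsum ψ hψ]
    simp only [h1, A, ENNReal.toReal_sum fun n _ => hb n, Complex.ofReal_sum]
  have hSS : ∫⁻ c, ‖S c‖ₑ ^ 2 = U * A := by
    have h3 : ∫ c, star (S c) * S c = ((U * A).toReal : ℂ) := by
      rw [hsum S hS]
      have h4 : ∀ n, ∫ c, star (P n c) * S c = ((U * b n).toReal : ℂ) := fun n => by
        simp only [S, Finset.mul_sum]
        rw [integral_finsetSum _ fun m _ => integrable_star_mul (hP n) (hP m)]
        simp_rw [h2]
        simp
      simp only [h4, A]
      rw [Finset.mul_sum, ENNReal.toReal_sum fun n _ => ENNReal.mul_ne_top hU (hb n),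
        Complex.ofReal_sum]
    rw [← ofReal_integral_star_mul_self hS, h3, Complex.ofReal_re,
      ENNReal.ofReal_toReal (ENNReal.mul_ne_top hU hA)]
  have hCS := enorm_integral_mul_sq_le (μ := volume) (f := fun c => star (S c))
    hS.star.aestronglyMeasurable hψ.aestronglyMeasurable
  rw [hSψ] at hCS
  have hstar : ∀ c, ‖star (S c)‖ₑ = ‖S c‖ₑ := fun c => by simp [enorm_eq_nnnorm]
  simp only [hstar, hSS] at hCS
  rw [← ofReal_norm, Complex.norm_real, Real.norm_of_nonneg ENNReal.toReal_nonneg,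
    ENNReal.ofReal_toReal hA] at hCS
  change A ≤ _
  by_cases h0 : A = 0
  · simp [h0]
  rw [sq, mul_comm U A, mul_assoc] at hCS
  rw [mul_comm]
  exact (ENNReal.mul_le_mul_iff_right h0 hA).1 hCS

/-! ### Expansion in the other particles and the inequality for antisymmetric functions -/

/-- Orthonormal vectors are `√2` apart, so the balls of radius `1/2` around them are disjoint.
Countability is what later permits exchanging sums and suprema with integrals. -/
theorem countable_of_orthonormal {𝕜 E : Type*} [RCLike 𝕜] [NormedAddCommGroup E]
    [InnerProductSpace 𝕜 E] [TopologicalSpace.SeparableSpace E] {ι : Type*} {v : ι → E}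
    (hv : Orthonormal 𝕜 v) : Countable ι := by
  have hdist : ∀ i j, i ≠ j → 1 ≤ dist (v i) (v j) := fun i j hij => by
    have h1 : ‖v i - v j‖ ^ 2 = 2 := by
      rw [@norm_sub_sq 𝕜, hv.2 hij, hv.1, hv.1]
      norm_num
    rw [dist_eq_norm]
    nlinarith [norm_nonneg (v i - v j)]
  refine Pairwise.countable_of_isOpen_disjoint (s := fun i => Metric.ball (v i) (1 / 2))
    (fun i j hij => ?_) (fun i => Metric.isOpen_ball) fun i => Metric.nonempty_ball.2 (by norm_num)
  exact Metric.ball_disjoint_ball (by linarith [hdist i j hij])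

/-- Parseval's identity for a Hilbert basis of `L^2`. -/
theorem tsum_enorm_integral_sq {α : Type*} [MeasurableSpace α] {μ : Measure α} [SFinite μ] {ι : Type*}
    (b : HilbertBasis ι ℂ (Lp ℂ 2 μ)) {f : α → ℂ} (hf : MemLp f 2 μ) :
    ∑' k, ‖∫ y, star (b k y) * f y ∂μ‖ₑ ^ 2 = ∫⁻ y, ‖f y‖ₑ ^ 2 ∂μ := by
  let F : Lp ℂ 2 μ := hf.toLp f
  have hinner : ∀ k, inner ℂ (b k) F = ∫ y, star (b k y) * f y ∂μ := fun k => by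
    rw [L2.inner_def]
    refine integral_congr_ae ?_
    filter_upwards [hf.coeFn_toLp] with y hy
    simp only [F, hy]
    simp [mul_comm]
  have hsum : HasSum (fun k => ‖∫ y, star (b k y) * f y ∂μ‖ ^ 2) (‖F‖ ^ 2) := by
    have h := (b.hasSum_inner_mul_inner F F).mapL Complex.reCLM
    convert h using 1
    · ext k
      rw [← hinner, ← inner_conj_symm F (b k), Complex.conj_mul']
      simp [← Complex.ofReal_pow]
    · rw [inner_self_eq_norm_sq_to_K]
      simp [← Complex.ofReal_pow]
  have hF : ENNReal.ofReal (‖F‖ ^ 2) = ∫⁻ y, ‖f y‖ₑ ^ 2 ∂μ := by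
    rw [← eLpNorm_two_sq, ENNReal.ofReal_pow (norm_nonneg _), Lp.norm_toLp,
      ENNReal.ofReal_toReal hf.2.ne]
  rw [← hF, ← hsum.tsum_eq, ENNReal.ofReal_tsum_of_nonneg (fun k => by positivity) hsum.summable]
  refine tsum_congr fun k => ?_
  rw [ENNReal.ofReal_pow (norm_nonneg _), ofReal_norm]

theorem exists_countable_hilbertBasis {d N : ℕ} (n : Fin N) :
    ∃ (ι : Type) (_ : Countable ι), Nonempty
      (HilbertBasis ι ℂ (Lp ℂ 2 (volume : Measure (Others d n)))) := by
  have : Fact ((2 : ℝ≥0∞) ≠ ⊤) := ⟨by simp⟩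
  have : SecondCountableTopology (Lp ℂ 2 (volume : Measure (Others d n))) :=
    Lp.SecondCountableTopology
  obtain ⟨w, b, _⟩ := exists_hilbertBasis ℂ (Lp ℂ 2 (volume : Measure (Others d n)))
  exact ⟨w, countable_of_orthonormal b.orthonormal, ⟨b⟩⟩

/-- Parseval in the other variables for almost every `x`, then Tonelli. Applied to the weak
derivatives of `ψ`, it yields the kinetic energy. -/
theorem lintegral_sum_enorm_slice {n : Fin N} {ι : Type} [Countable ι]
    (b : HilbertBasis ι ℂ (Lp ℂ 2 (volume : Measure (Others d n)))) {F : Config d N → ℂ}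
    (hF : MemLp F 2) : ∑' k, ∫⁻ x, ‖slice n F (b k) x‖ₑ ^ 2 = ∫⁻ c, ‖F c‖ₑ ^ 2 := by
  have hF' := memLp_insertParticle hF n
  rw [← lintegral_tsum fun k =>
    ((memLp_slice hF (Lp.memLp (b k))).aestronglyMeasurable.enorm).pow_const 2,
    ← lintegral_insertParticle n,
    lintegral_prod _ ((hF'.aestronglyMeasurable.enorm).pow_const 2)]
  refine lintegral_congr_ae ?_
  filter_upwards [MemLp.ae_section hF'] with x hx
  exact tsum_enorm_integral_sq b hx

/-- By Fubini the coefficients of the slices against `u` are those of `annihilate n u F` in the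
basis, which reduces the Bessel sum to the Pauli bound. -/
theorem integral_star_mul_slice {n : Fin N} {F : Config d N → ℂ} (hF : MemLp F 2)
    {u : Rd d → ℂ} (hu : MemLp u 2) {w : Others d n → ℂ} (hw : MemLp w 2) :
    ∫ x, star (u x) * slice n F w x = ∫ y, star (w y) * annihilate n u F y := by
  have hu' : MemLp (fun x => star (u x)) 2 := hu.star
  have hw' : MemLp (fun y => star (w y)) 2 := hw.star
  have hF' := memLp_insertParticle hF n
  exact (integral_tensor_mul hF' hu' hw').symm.trans (integral_tensor_mul_symm hF' hu' hw')

/-- The Lieb-Thirring inequality for antisymmetric functions with the constant of the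
Lieb-Thirring inequality for orthonormal systems. -/
theorem IsLTConstant.antisymmetric {K : ℝ≥0∞} (hK : IsLTConstant d K) {ψ : Config d N → ℂ}
    (hψ : MemH1 (basisConfig d N) ψ) (hanti : Antisymmetric ψ) (h0 : ∫⁻ c, ‖ψ c‖ₑ ^ 2 ≠ 0) :
    K * ∫⁻ x, density ψ x ^ (1 + 2 / (d : ℝ)) ≤
      (∫⁻ c, ‖ψ c‖ₑ ^ 2) ^ (2 / (d : ℝ)) * kineticEnergy (basisConfig d N) ψ := by
  choose ι hι hb using fun n : Fin N => exists_countable_hilbertBasis (d := d) n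
  let b : ∀ n, HilbertBasis (ι n) ℂ (Lp ℂ 2 (volume : Measure (Others d n))) := fun n => (hb n).some
  let κ := Σ n, ι n
  -- These functions represent the one-particle operator as `∑ |f k⟩⟨f k|`, with one basis for each
  -- particle.
  let f : κ → Rd d → ℂ := fun k => slice k.1 ψ (b k.1 k.2)
  have hf : ∀ k, MemH1 (basisRd d) (f k) := fun k => memH1_slice hψ (Lp.memLp _)
  choose g hg hg2 using hψ.2
  have hkin : ∀ s : Finset κ, ∑ k : s, kineticEnergy (basisRd d) (f k) ≤
      kineticEnergy (basisConfig d N) ψ := fun s => by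
    rw [Finset.sum_coe_sort s fun k => kineticEnergy (basisRd d) (f k)]
    refine (ENNReal.sum_le_tsum s).trans (le_of_eq ?_)
    rw [ENNReal.tsum_sigma', tsum_fintype, kineticEnergy_eq hg, Fintype.sum_prod_type]
    refine Finset.sum_congr rfl fun n _ => ?_
    have h1 : ∀ k : ι n, kineticEnergy (basisRd d) (f ⟨n, k⟩) =
        ∑ i, ∫⁻ x, ‖slice n (g (n, i)) (b n k) x‖ₑ ^ 2 := fun k =>
      kineticEnergy_eq fun i => hasWeakDeriv_slice hψ.1 (hg2 (n, i)) (hg (n, i)) (Lp.memLp _)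
    simp_rw [h1]
    rw [Summable.tsum_finsetSum fun i _ => ENNReal.summable]
    exact Finset.sum_congr rfl fun i _ => lintegral_sum_enorm_slice (b n) (hg2 (n, i))
  have hbes : ∀ (s : Finset κ) (u : Rd d → ℂ), MemLp u 2 →
      ∑ k : s, ‖∫ x, star (u x) * f k x‖ₑ ^ 2 ≤ (∫⁻ c, ‖ψ c‖ₑ ^ 2) * ∫⁻ x, ‖u x‖ₑ ^ 2 :=
    fun s u hu => by
    rw [Finset.sum_coe_sort s fun k => ‖∫ x, star (u x) * f k x‖ₑ ^ 2]
    refine (ENNReal.sum_le_tsum s).trans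
      (le_trans (le_of_eq ?_) (sum_lintegral_annihilate_le hψ.1 hanti hu))
    rw [ENNReal.tsum_sigma', tsum_fintype]
    refine Finset.sum_congr rfl fun n _ => ?_
    simp_rw [f, integral_star_mul_slice hψ.1 hu (Lp.memLp _)]
    exact tsum_enorm_integral_sq (b n) (memLp_annihilate hu hψ.1)
  have hLT : ∀ s : Finset κ, K * ∫⁻ x, (∑ k ∈ s, ‖f k x‖ₑ ^ 2) ^ (1 + 2 / (d : ℝ)) ≤
      (∫⁻ c, ‖ψ c‖ₑ ^ 2) ^ (2 / (d : ℝ)) * kineticEnergy (basisConfig d N) ψ := fun s => by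
    have h := hK.of_bessel (f := fun k : s => f k) (fun k => hf k) h0
      (memLp_two_iff_lintegral.1 hψ.1).2.ne (hbes s)
    simp_rw [fun x => Finset.sum_coe_sort s fun k => ‖f k x‖ₑ ^ 2] at h
    exact h.trans (mul_le_mul_right (hkin s) _)
  have hdens : ∀ᵐ x, density ψ x = ⨆ s : Finset κ, ∑ k ∈ s, ‖f k x‖ₑ ^ 2 := by
    filter_upwards [ae_all_iff.2 fun n => MemLp.ae_section (memLp_insertParticle hψ.1 n)] with x hx
    rw [← ENNReal.tsum_eq_iSup_sum, ENNReal.tsum_sigma', tsum_fintype]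
    exact Finset.sum_congr rfl fun n _ => (tsum_enorm_integral_sq (b n) (hx n)).symm
  have hp : 0 < 1 + 2 / (d : ℝ) := by positivity
  -- The bound `hLT` is uniform in the finite set `s`, so monotone convergence along finite sets
  -- passes it to the full density.
  have hsup : ∫⁻ x, density ψ x ^ (1 + 2 / (d : ℝ)) =
      ⨆ s : Finset κ, ∫⁻ x, (∑ k ∈ s, ‖f k x‖ₑ ^ 2) ^ (1 + 2 / (d : ℝ)) := by
    rw [← lintegral_iSup_directed]
    · refine lintegral_congr_ae ?_
      filter_upwards [hdens] with x hx
      rw [hx]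
      exact (ENNReal.orderIsoRpow _ hp).map_iSup _
    · exact fun s => (Finset.aemeasurable_fun_sum _ fun k _ =>
        ((hf k).1.aestronglyMeasurable.enorm).pow_const 2).pow_const _
    · refine Monotone.directed_le fun s t hst x => ?_
      exact ENNReal.rpow_le_rpow (Finset.sum_le_sum_of_subset hst) hp.le
  rw [hsup, ENNReal.mul_iSup]
  exact iSup_le hLT

/-! ### Weak derivatives under the Fourier transform -/

theorem hasFDerivAt_comp_smul {χ : Rd d → ℝ} (hχ : ContDiff ℝ ∞ χ) (r : ℝ) (x : Rd d) :
    HasFDerivAt (fun x => χ (r • x)) (r • fderiv ℝ χ (r • x)) x := by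
  have h1 : HasFDerivAt (fun x : Rd d => r • x) (r • ContinuousLinearMap.id ℝ (Rd d)) x :=
    (hasFDerivAt_id x).const_smul r
  have h2 := (hχ.differentiable (by simp) (r • x)).hasFDerivAt.comp x h1
  exact h2.congr_fderiv (by ext v; simp)

/-- The integration by parts formula for a smooth function that is in `L^2` with its derivative. -/
theorem HasWeakDeriv.integral_of_memLp {v : Rd d} {u g : Rd d → ℂ} (h : HasWeakDeriv v u g)
    (hu : MemLp u 2) (hg : MemLp g 2) {φ : Rd d → ℝ} (hφ : ContDiff ℝ ∞ φ)
    (hφ2 : MemLp φ 2) (hφ' : MemLp (fun x => fderiv ℝ φ x v) 2) :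
    ∫ x, (fderiv ℝ φ x v) • u x = -∫ x, φ x • g x := by
  -- The cutoffs `χ(r x)` with `r → 0` make `φ` compactly supported; the derivative of the cutoff
  -- carries a factor `r` and disappears by dominated convergence.
  let χ : ContDiffBump (0 : Rd d) := ⟨1, 2, one_pos, one_lt_two⟩
  have hχ : ContDiff ℝ ∞ χ := χ.contDiff
  let r : ℕ → ℝ := fun n => 1 / ((n : ℝ) + 1)
  have hr : Filter.Tendsto r Filter.atTop (nhds 0) := tendsto_one_div_add_atTop_nhds_zero_nat
  have hr0 : ∀ n, 0 < r n := fun n => by positivity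
  have hr1 : ∀ n, r n ≤ 1 := fun n => by
    simp only [r]
    rw [div_le_one (by positivity)]
    have : (0 : ℝ) ≤ n := by positivity
    linarith
  have hχ'c : Continuous fun x => fderiv ℝ χ x v :=
    (hχ.continuous_fderiv (by simp)).clm_apply continuous_const
  obtain ⟨B, hB⟩ := hχ'c.bounded_above_of_compact_support (χ.hasCompactSupport.fderiv_apply ℝ v)
  have hrx : ∀ x : Rd d, Filter.Tendsto (fun n => r n • x) Filter.atTop (nhds 0) := fun x => by
    simpa using hr.smul_const x
  have hχ1 : ∀ x, Filter.Tendsto (fun n => χ (r n • x)) Filter.atTop (nhds 1) := fun x => by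
    have h0 : χ (0 : Rd d) = 1 := χ.one_of_mem_closedBall (by simp [χ])
    have := (χ.continuous.tendsto 0).comp (hrx x)
    rwa [h0] at this
  have hφd : ∀ x, HasFDerivAt φ (fderiv ℝ φ x) x := fun x =>
    (hφ.differentiable (by simp) x).hasFDerivAt
  have hprod : ∀ n x, fderiv ℝ (fun x => χ (r n • x) * φ x) x v =
      χ (r n • x) * fderiv ℝ φ x v + φ x * (r n * fderiv ℝ χ (r n • x) v) := fun n x => by
    have h3 : HasFDerivAt (fun x => χ (r n • x) * φ x) _ x :=
      (hasFDerivAt_comp_smul hχ (r n) x).mul (hφd x)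
    rw [h3.fderiv]
    simp
  have hsmooth : ∀ n, ContDiff ℝ ∞ fun x : Rd d => χ (r n • x) := fun n =>
    hχ.comp (contDiff_const_smul (r n))
  have hcpt : ∀ n, HasCompactSupport fun x : Rd d => χ (r n • x) := fun n =>
    χ.hasCompactSupport.comp_smul (hr0 n).ne'
  have heq : ∀ n, ∫ x, (χ (r n • x) * fderiv ℝ φ x v + φ x * (r n * fderiv ℝ χ (r n • x) v)) • u x
      = -∫ x, (χ (r n • x) * φ x) • g x := fun n => by
    have h3 := h.2.2 _ ((hsmooth n).mul hφ) (hcpt n).mul_right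
    simpa only [hprod] using h3
  have hφc : Continuous φ := hφ.continuous
  have hφ'c : Continuous fun x => fderiv ℝ φ x v :=
    (hφ.continuous_fderiv (by simp)).clm_apply continuous_const
  have hmain : ∀ (a : Rd d → ℝ) (w : Rd d → ℂ), MemLp a 2 → MemLp w 2 →
      Integrable fun x => ‖a x‖ * ‖w x‖ := fun a w ha hw => MemLp.integrable_mul ha.norm hw.norm
  have hL : Filter.Tendsto (fun n => ∫ x, (χ (r n • x) * fderiv ℝ φ x v +
      φ x * (r n * fderiv ℝ χ (r n • x) v)) • u x) Filter.atTop
      (nhds (∫ x, (fderiv ℝ φ x v) • u x)) := by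
    refine tendsto_integral_of_dominated_convergence
      (fun x => ‖fderiv ℝ φ x v‖ * ‖u x‖ + B * (‖φ x‖ * ‖u x‖)) (fun n => ?_)
      ((hmain _ _ hφ' hu).add ((hmain _ _ hφ2 hu).const_mul B))
      (fun n => Filter.Eventually.of_forall fun x => ?_)
      (Filter.Eventually.of_forall fun x => ?_)
    · have h4 : Continuous fun x => χ (r n • x) * fderiv ℝ φ x v +
          φ x * (r n * fderiv ℝ χ (r n • x) v) := ((hsmooth n).continuous.mul hφ'c).add
        (hφc.mul (continuous_const.mul (hχ'c.comp (continuous_const_smul _))))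
      exact h4.aestronglyMeasurable.smul hu.aestronglyMeasurable
    · rw [norm_smul]
      have h4 : ‖χ (r n • x) * fderiv ℝ φ x v‖ ≤ ‖fderiv ℝ φ x v‖ := by
        rw [norm_mul, Real.norm_of_nonneg χ.nonneg]
        exact mul_le_of_le_one_left (norm_nonneg _) χ.le_one
      have h5 : ‖φ x * (r n * fderiv ℝ χ (r n • x) v)‖ ≤ B * ‖φ x‖ := by
        rw [norm_mul, norm_mul, Real.norm_of_nonneg (hr0 n).le, mul_comm]
        gcongr
        exact (mul_le_of_le_one_left (norm_nonneg _) (hr1 n)).trans (hB _)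
      calc _ ≤ (‖fderiv ℝ φ x v‖ + B * ‖φ x‖) * ‖u x‖ := by
            gcongr
            exact (norm_add_le _ _).trans (add_le_add h4 h5)
        _ = _ := by ring
    · have h4 := (hχ'c.tendsto 0).comp (hrx x)
      have h5 := ((hχ1 x).mul_const (fderiv ℝ φ x v)).add ((hr.mul h4).const_mul (φ x))
      simpa using h5.smul_const (u x)
  have hR : Filter.Tendsto (fun n => -∫ x, (χ (r n • x) * φ x) • g x) Filter.atTop
      (nhds (-∫ x, φ x • g x)) := by
    refine Filter.Tendsto.neg (tendsto_integral_of_dominated_convergence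
      (fun x => ‖φ x‖ * ‖g x‖) (fun n => ?_) (hmain _ _ hφ2 hg)
      (fun n => Filter.Eventually.of_forall fun x => ?_)
      (Filter.Eventually.of_forall fun x => ?_))
    · exact ((hsmooth n).continuous.mul hφc).aestronglyMeasurable.smul hg.aestronglyMeasurable
    · rw [norm_smul, norm_mul, Real.norm_of_nonneg χ.nonneg]
      gcongr
      exact mul_le_of_le_one_left (norm_nonneg _) χ.le_one
    · simpa using ((hχ1 x).mul_const (φ x)).smul_const (g x)
  simp_rw [heq] at hL
  exact tendsto_nhds_unique hL hR

open SchwartzMap LineDeriv in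
-- Test functions in `HasWeakDeriv` are real-valued, so the real and imaginary parts of `φ` are
-- treated separately.
theorem HasWeakDeriv.integral_schwartz {v : Rd d} {u g : Rd d → ℂ} (h : HasWeakDeriv v u g)
    (hu : MemLp u 2) (hg : MemLp g 2) (φ : 𝓢(Rd d, ℂ)) :
    ∫ x, (∂_{v} φ) x • u x = -∫ x, φ x • g x := by
  have hdiff : ∀ x, HasFDerivAt φ (fderiv ℝ φ x) x := fun x => φ.hasFDerivAt x
  have hre : ∀ x, fderiv ℝ (fun x => (φ x).re) x v = ((∂_{v} φ) x).re := fun x => by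
    have h1 : HasFDerivAt (fun x => (φ x).re) _ x := Complex.reCLM.hasFDerivAt.comp x (hdiff x)
    rw [h1.fderiv, SchwartzMap.lineDerivOp_apply_eq_fderiv]
    rfl
  have him : ∀ x, fderiv ℝ (fun x => (φ x).im) x v = ((∂_{v} φ) x).im := fun x => by
    have h1 : HasFDerivAt (fun x => (φ x).im) _ x := Complex.imCLM.hasFDerivAt.comp x (hdiff x)
    rw [h1.fderiv, SchwartzMap.lineDerivOp_apply_eq_fderiv]
    rfl
  have h2 : MemLp φ 2 := φ.memLp 2
  have h2' : MemLp (∂_{v} φ : 𝓢(Rd d, ℂ)) 2 := (∂_{v} φ : 𝓢(Rd d, ℂ)).memLp 2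
  have hr := h.integral_of_memLp hu hg (φ := fun x => (φ x).re)
    (Complex.reCLM.contDiff.comp (φ.smooth ⊤)) h2.re (by simp only [hre]; exact h2'.re)
  have hi := h.integral_of_memLp hu hg (φ := fun x => (φ x).im)
    (Complex.imCLM.contDiff.comp (φ.smooth ⊤)) h2.im (by simp only [him]; exact h2'.im)
  simp only [hre, him] at hr hi
  have key : ∀ (a w : Rd d → ℂ), MemLp a 2 → MemLp w 2 → ∫ x, a x • w x =
      (∫ x, (a x).re • w x) + Complex.I * ∫ x, (a x).im • w x := fun a w ha hw => by
    have r1 : MemLp (fun x => (a x).re) 2 := ha.re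
    have r2 : MemLp (fun x => (a x).im) 2 := ha.im
    have i1 : Integrable fun x => (a x).re • w x := by
      simp only [Complex.real_smul]
      exact r1.ofReal.integrable_mul hw
    have i2 : Integrable fun x => (a x).im • w x := by
      simp only [Complex.real_smul]
      exact r2.ofReal.integrable_mul hw
    rw [← integral_const_mul, ← integral_add i1 (i2.const_mul _)]
    refine integral_congr_ae (Filter.Eventually.of_forall fun x => ?_)
    simp only [Complex.real_smul, smul_eq_mul]
    conv_lhs => rw [← Complex.re_add_im (a x)]
    ring
  rw [key _ _ h2' hu, key _ _ h2 hg, hr, hi]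
  ring

open SchwartzMap LineDeriv FourierTransform TemperedDistribution in
/-- The Fourier transform turns weak derivatives into multiplication by `2πi⟨ξ, v⟩`. -/
theorem HasWeakDeriv.fourier_ae_eq {v : Rd d} {u g : Rd d → ℂ} (h : HasWeakDeriv v u g)
    (hu : MemLp u 2) (hg : MemLp g 2) :
    ∀ᵐ ξ, (𝓕 (hg.toLp g) : Lp ℂ 2 (volume : Measure (Rd d))) ξ =
      (2 * Real.pi * Complex.I) * ((inner ℝ ξ v : ℝ) : ℂ) *
        (𝓕 (hu.toLp u) : Lp ℂ 2 (volume : Measure (Rd d))) ξ := by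
  let U : Lp ℂ 2 (volume : Measure (Rd d)) := hu.toLp u
  let G : Lp ℂ 2 (volume : Measure (Rd d)) := hg.toLp g
  -- As tempered distributions `G = ∂_v U`, where the Fourier transform of a derivative is known;
  -- compactly supported test functions then bring the identity back to an almost everywhere one.
  have hdist : (G : 𝓢'(Rd d, ℂ)) = ∂_{v} (U : 𝓢'(Rd d, ℂ)) := by
    ext φ
    rw [lineDerivOp_apply_apply, Lp.toTemperedDistribution_apply, map_neg,
      Lp.toTemperedDistribution_apply]
    have e1 : ∫ x, φ x • G x = ∫ x, φ x • g x :=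
      integral_congr_ae (by filter_upwards [hg.coeFn_toLp] with x hx; simp only [G, hx])
    have e2 : ∫ x, (∂_{v} φ) x • U x = ∫ x, (∂_{v} φ) x • u x :=
      integral_congr_ae (by filter_upwards [hu.coeFn_toLp] with x hx; simp only [U, hx])
    rw [e1, e2, h.integral_schwartz hu hg, neg_neg]
  have hF : ((𝓕 G : Lp ℂ 2 (volume : Measure (Rd d))) : 𝓢'(Rd d, ℂ)) =
      (2 * Real.pi * Complex.I) • TemperedDistribution.smulLeftCLM ℂ (fun ξ : Rd d => ((inner ℝ ξ v : ℝ) : ℂ))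
        ((𝓕 U : Lp ℂ 2 (volume : Measure (Rd d))) : 𝓢'(Rd d, ℂ)) := by
    rw [← Lp.fourier_toTemperedDistribution_eq, ← Lp.fourier_toTemperedDistribution_eq, hdist,
      TemperedDistribution.fourier_lineDerivOp_eq]
  have hc : Continuous fun ξ : Rd d =>
      (2 * Real.pi * Complex.I) * ((inner ℝ ξ v : ℝ) : ℂ) := by fun_prop
  refine ae_eq_of_integral_contDiff_smul_eq ((Lp.memLp _).locallyIntegrable (by norm_num))
    ?_ fun φ hφ hφc => ?_
  · have := ((Lp.memLp (𝓕 U : Lp ℂ 2 (volume : Measure (Rd d)))).locallyIntegrable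
      (by norm_num))
    have h2 := (locallyIntegrableOn_univ.2 this).continuousOn_mul hc.continuousOn
      isOpen_univ.isLocallyClosed
    exact locallyIntegrableOn_univ.1 h2
  · have h1 : HasCompactSupport (Complex.ofRealCLM ∘ φ) := hφc.comp_left rfl
    have h2 : ContDiff ℝ ∞ (Complex.ofRealCLM ∘ φ) := by fun_prop
    have h3 := congrArg (fun T : 𝓢'(Rd d, ℂ) => T (h1.toSchwartzMap h2)) hF
    have htg : (fun ξ : Rd d => ((inner ℝ ξ v : ℝ) : ℂ)).HasTemperateGrowth := by fun_prop
    have h4 : ∀ T : 𝓢'(Rd d, ℂ), ∀ c : ℂ, ∀ ψ, (c • T) ψ = c • T ψ := fun _ _ _ => rfl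
    simp only [h4, Lp.toTemperedDistribution_apply, TemperedDistribution.smulLeftCLM_apply_apply]
      at h3
    refine Eq.trans ?_ (h3.trans ?_)
    · simp [G]
    · rw [← integral_smul]
      refine integral_congr_ae (Filter.Eventually.of_forall fun ξ => ?_)
      simp only [SchwartzMap.smulLeftCLM_apply_apply htg]
      simp [U]
      ring

/-! ### Rumin's proof of the Lieb-Thirring inequality -/

section Rumin

open SchwartzMap FourierTransform

/-- The inverse transform is the Fourier integral for the pairing `-⟨x, y⟩`, which is symmetric. -/
theorem integral_fourierInv_smul_eq_of_integrable {f g : Rd d → ℂ} (hf : Integrable f)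
    (hg : Integrable g) : ∫ x, (𝓕⁻ f) x • g x = ∫ x, f x • (𝓕⁻ g) x := by
  have hc : Continuous fun p : Rd d × Rd d => (-innerₗ (Rd d)) p.1 p.2 := by
    simp only [LinearMap.neg_apply, innerₗ_apply_apply]
    fun_prop
  have h := VectorFourier.integral_fourierIntegral_smul_eq_flip (L := -innerₗ (Rd d))
    Real.continuous_fourierChar hc hf hg
  have hflip : (-innerₗ (Rd d)).flip = -innerₗ (Rd d) := by
    ext x y
    simp [real_inner_comm]
  rw [hflip] at h
  exact h

theorem continuous_fourierInv_of_integrable {f : Rd d → ℂ} (hf : Integrable f) :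
    Continuous (𝓕⁻ f) := by
  have hc : Continuous fun p : Rd d × Rd d => (-innerₗ (Rd d)) p.1 p.2 := by
    simp only [LinearMap.neg_apply, innerₗ_apply_apply]
    fun_prop
  exact VectorFourier.fourierIntegral_continuous Real.continuous_fourierChar hc hf

/-- On `L^1 ∩ L^2` the `L^2` inverse Fourier transform is given by the Fourier integral. -/
theorem fourierInv_toLp_ae_eq {h : Rd d → ℂ} (h1 : Integrable h) (h2 : MemLp h 2) :
    (𝓕⁻ (h2.toLp h) : Lp ℂ 2 (volume : Measure (Rd d))) =ᵐ[volume] 𝓕⁻ h := by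
  refine ae_eq_of_integral_contDiff_smul_eq ((Lp.memLp _).locallyIntegrable (by norm_num))
    (continuous_fourierInv_of_integrable h1).locallyIntegrable fun φ hφ hφc => ?_
  have hc1 : HasCompactSupport (Complex.ofRealCLM ∘ φ) := hφc.comp_left rfl
  have hc2 : ContDiff ℝ ∞ (Complex.ofRealCLM ∘ φ) := by fun_prop
  let Φ : 𝓢(Rd d, ℂ) := hc1.toSchwartzMap hc2
  have e1 := congrArg (fun T : 𝓢'(Rd d, ℂ) => T Φ)
    (Lp.fourierInv_toTemperedDistribution_eq (h2.toLp h))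
  simp only [TemperedDistribution.fourierInv_apply, Lp.toTemperedDistribution_apply] at e1
  have e2 : ∫ x, (𝓕⁻ Φ) x • (h2.toLp h) x = ∫ x, (𝓕⁻ (Φ : Rd d → ℂ)) x • h x := by
    refine integral_congr_ae ?_
    filter_upwards [h2.coeFn_toLp] with x hx
    rw [hx, SchwartzMap.fourierInv_coe]
  rw [e2, integral_fourierInv_smul_eq_of_integrable Φ.integrable h1] at e1
  have e3 : ∀ F : Rd d → ℂ, ∫ x, φ x • F x = ∫ x, Φ x • F x := fun F => by
    simp [Φ]
  rw [e3, e3, e1]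

theorem lintegral_enorm_sq_coeFn {α : Type*} [MeasurableSpace α] {μ : Measure α} [SFinite μ]
    (F : Lp ℂ 2 μ) : ∫⁻ x, ‖F x‖ₑ ^ 2 ∂μ = ‖F‖ₑ ^ 2 := by
  rw [← eLpNorm_two_sq, Lp.enorm_def]

theorem norm_fourierInv_Lp (F : Lp ℂ 2 (volume : Measure (Rd d))) : ‖𝓕⁻ F‖ = ‖F‖ := by
  rw [← Lp.norm_fourier_eq (𝓕⁻ F), FourierTransform.fourier_fourierInv_eq]

/-- The part of frequencies `|ξ|² < E` of the function with Fourier transform `h`. -/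
noncomputable def lowPass (h : Rd d → ℂ) (E : ℝ) : Rd d → ℂ :=
  𝓕⁻ ({ξ : Rd d | ‖ξ‖ ^ 2 < E}.indicator h)

theorem measurableSet_lowFreq (E : ℝ) : MeasurableSet {ξ : Rd d | ‖ξ‖ ^ 2 < E} :=
  measurableSet_lt (by fun_prop) measurable_const

theorem volume_lowFreq {E : ℝ} (hE : 0 < E) :
    volume {ξ : Rd d | ‖ξ‖ ^ 2 < E} =
      ENNReal.ofReal (√E ^ d) * volume (Metric.ball (0 : Rd d) 1) := by
  have h1 : {ξ : Rd d | ‖ξ‖ ^ 2 < E} = Metric.ball 0 √E := by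
    ext ξ
    simp [Real.lt_sqrt (norm_nonneg ξ)]
  rw [h1, Measure.addHaar_ball_of_pos _ _ (Real.sqrt_pos.2 hE), finrank_euclideanSpace_fin]

theorem volume_lowFreq_lt_top (E : ℝ) : volume {ξ : Rd d | ‖ξ‖ ^ 2 < E} < ⊤ := by
  refine lt_of_le_of_lt (measure_mono fun ξ (hξ : ‖ξ‖ ^ 2 < E) => ?_)
    (volume_lowFreq (d := d) (E := max E 1) (by positivity) ▸
      ENNReal.mul_lt_top ENNReal.ofReal_lt_top measure_ball_lt_top)
  exact lt_of_lt_of_le hξ (le_max_left E 1)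

/-- Joint measurability in `(E, x)` serves Tonelli when the `x` and `E` integrals are exchanged. -/
theorem measurable_lowPass {h : Rd d → ℂ} (hh : Measurable h) :
    Measurable fun p : ℝ × Rd d => lowPass h p.1 p.2 := by
  have h1 : StronglyMeasurable fun q : (ℝ × Rd d) × Rd d =>
      Real.fourierChar (inner ℝ q.2 q.1.2) • {ξ : Rd d | ‖ξ‖ ^ 2 < q.1.1}.indicator h q.2 := by
    refine Measurable.stronglyMeasurable ?_
    simp only [Circle.smul_def, smul_eq_mul]
    refine Measurable.mul ?_ ?_
    · have : Continuous fun q : (ℝ × Rd d) × Rd d =>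
          ((Real.fourierChar (inner ℝ q.2 q.1.2) : Circle) : ℂ) :=
        continuous_subtype_val.comp (Real.continuous_fourierChar.comp (by fun_prop))
      exact this.measurable
    · have h2 : MeasurableSet {q : (ℝ × Rd d) × Rd d | ‖q.2‖ ^ 2 < q.1.1} :=
        measurableSet_lt (by fun_prop) (by fun_prop)
      exact (hh.comp measurable_snd).indicator h2
  have h3 := h1.integral_prod_right' (ν := volume)
  convert h3.measurable using 2 with p
  exact Real.fourierInv_eq _ _

/-- Bessel's inequality for the low frequency part of an orthonormal system. -/
theorem sum_enorm_lowPass_sq_le {κ : Type*} [Fintype κ]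
    {h : κ → Lp ℂ 2 (volume : Measure (Rd d))} (hh : Orthonormal ℂ h) (E : ℝ) (x : Rd d) :
    ∑ k, ‖lowPass (h k) E x‖ₑ ^ 2 ≤ volume {ξ : Rd d | ‖ξ‖ ^ 2 < E} := by
  let S : Set (Rd d) := {ξ | ‖ξ‖ ^ 2 < E}
  have hS : MeasurableSet S := measurableSet_lowFreq E
  -- At fixed `x`, `lowPass (h k) E x` has the modulus of the inner product of `h k` with this
  -- truncated exponential, whose squared norm is the volume of `S`.
  let e : Rd d → ℂ := S.indicator fun ξ => ((Real.fourierChar (-inner ℝ ξ x) : Circle) : ℂ)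
  have hcont : Continuous fun ξ : Rd d => ((Real.fourierChar (-inner ℝ ξ x) : Circle) : ℂ) :=
    continuous_subtype_val.comp (Real.continuous_fourierChar.comp (by fun_prop))
  have hnorm : ∫⁻ ξ, ‖e ξ‖ₑ ^ 2 = volume S := by
    rw [← lintegral_indicator_one hS]
    refine lintegral_congr fun ξ => ?_
    by_cases hξ : ξ ∈ S
    · simp only [e, Set.indicator_of_mem hξ, Pi.one_apply, ← ofReal_norm, Circle.norm_coe]
      simp
    · simp [e, hξ]
  have he : MemLp e 2 := memLp_two_iff_lintegral.2
    ⟨(hcont.measurable.indicator hS).aestronglyMeasurable, hnorm ▸ volume_lowFreq_lt_top E⟩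
  have hinner : ∀ k, ‖lowPass (h k) E x‖ = ‖inner ℂ (h k) (he.toLp e)‖ := fun k => by
    rw [norm_inner_symm, L2.inner_def, lowPass, Real.fourierInv_eq]
    congr 1
    refine integral_congr_ae ?_
    filter_upwards [he.coeFn_toLp] with ξ hξ
    rw [hξ]
    by_cases hξS : ξ ∈ S
    · have hξ' : ‖ξ‖ ^ 2 < E := hξS
      simp [e, hξS, Set.indicator, Circle.smul_def, hξ', AddChar.map_neg_eq_inv, mul_comm]
    · have hξ' : ¬ ‖ξ‖ ^ 2 < E := hξS
      simp [e, hξS, Set.indicator, hξ']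
  have hB := hh.sum_inner_products_le (he.toLp e) (s := Finset.univ)
  have hE : ENNReal.ofReal (‖he.toLp e‖ ^ 2) = volume S := by
    rw [← hnorm, ← eLpNorm_two_sq, ENNReal.ofReal_pow (norm_nonneg _), Lp.norm_toLp,
      ENNReal.ofReal_toReal he.2.ne]
  rw [sum_enorm_sq_eq_ofReal, ← hE]
  simp_rw [hinner]
  exact ENNReal.ofReal_le_ofReal hB

/-- Plancherel's identity for the high frequency part. -/
theorem lintegral_sub_lowPass {u : Rd d → ℂ} (hu : MemLp u 2) (E : ℝ) :
    ∫⁻ x, ‖u x - lowPass (𝓕 (hu.toLp u) : Lp ℂ 2 (volume : Measure (Rd d))) E x‖ₑ ^ 2 =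
      ∫⁻ ξ in {ξ : Rd d | E ≤ ‖ξ‖ ^ 2},
        ‖(𝓕 (hu.toLp u) : Lp ℂ 2 (volume : Measure (Rd d))) ξ‖ₑ ^ 2 := by
  let S : Set (Rd d) := {ξ | ‖ξ‖ ^ 2 < E}
  have hS : MeasurableSet S := measurableSet_lowFreq E
  let H : Lp ℂ 2 (volume : Measure (Rd d)) := 𝓕 (hu.toLp u)
  have hl : MemLp (S.indicator H) 2 := (Lp.memLp H).indicator hS
  have hh : MemLp (Sᶜ.indicator H) 2 := (Lp.memLp H).indicator hS.compl
  -- `S` has finite volume, so the low part is in `L^1 ∩ L^2` and the pointwise integral `lowPass`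
  -- agrees almost everywhere with the `L²` inverse transform.
  have hl1 : Integrable (S.indicator H) := by
    rw [integrable_indicator_iff hS]
    have : IsFiniteMeasure ((volume : Measure (Rd d)).restrict S) :=
      ⟨by simpa using volume_lowFreq_lt_top E⟩
    exact ((Lp.memLp H).restrict S).integrable (by norm_num)
  have hsum : H = hl.toLp _ + hh.toLp _ := by
    refine Lp.ext ?_
    filter_upwards [hl.coeFn_toLp, hh.coeFn_toLp, Lp.coeFn_add (hl.toLp _) (hh.toLp _)]
      with ξ h1 h2 h3
    rw [h3, Pi.add_apply, h1, h2, Set.indicator_self_add_compl_apply]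
  let W : Lp ℂ 2 (volume : Measure (Rd d)) := 𝓕⁻ (hh.toLp _)
  have hU : hu.toLp u = 𝓕⁻ (hl.toLp _) + W := by
    rw [← FourierTransform.fourierInv_add, ← hsum, FourierTransform.fourierInv_fourier_eq]
  have hae : ∀ᵐ x, u x - lowPass H E x = W x := by
    have h4 := Lp.coeFn_add (𝓕⁻ (hl.toLp (S.indicator H))) W
    rw [← hU] at h4
    filter_upwards [hu.coeFn_toLp, h4, fourierInv_toLp_ae_eq hl1 hl] with x h1 h2 h3
    rw [← h1, h2, Pi.add_apply, h3]
    exact add_sub_cancel_left _ _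
  rw [lintegral_congr_ae (hae.mono fun x hx => by simp only [H] at hx; simp only [hx] :
    _ =ᵐ[volume] fun x => ‖W x‖ₑ ^ 2), lintegral_enorm_sq_coeFn, ← ofReal_norm,
    norm_fourierInv_Lp, ofReal_norm, ← lintegral_enorm_sq_coeFn]
  have hcompl : {ξ : Rd d | E ≤ ‖ξ‖ ^ 2} = Sᶜ := by
    ext ξ; simp [S]
  rw [hcompl, ← lintegral_indicator hS.compl]
  refine lintegral_congr_ae ?_
  filter_upwards [hh.coeFn_toLp] with ξ hξ
  rw [hξ]
  by_cases h : ξ ∈ Sᶜ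
  · rw [Set.indicator_of_mem h, Set.indicator_of_mem h]
  · rw [Set.indicator_of_notMem h, Set.indicator_of_notMem h]; simp

/-- The kinetic energy bounds the second moment of the Fourier transform. -/
theorem lintegral_norm_sq_mul_fourier_le {u : Rd d → ℂ} (hu : MemH1 (basisRd d) u) :
    ∫⁻ ξ, ENNReal.ofReal (‖ξ‖ ^ 2) *
      ‖(𝓕 (hu.1.toLp u) : Lp ℂ 2 (volume : Measure (Rd d))) ξ‖ₑ ^ 2 ≤
        kineticEnergy (basisRd d) u := by
  choose g hg hg2 using hu.2
  let H : Lp ℂ 2 (volume : Measure (Rd d)) := 𝓕 (hu.1.toLp u)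
  rw [kineticEnergy_eq hg]
  have hpt : ∀ᵐ ξ, ENNReal.ofReal (‖ξ‖ ^ 2) * ‖H ξ‖ₑ ^ 2 ≤
      ∑ i, ‖(𝓕 ((hg2 i).toLp (g i)) : Lp ℂ 2 (volume : Measure (Rd d))) ξ‖ₑ ^ 2 := by
    filter_upwards [ae_all_iff.2 fun i => (hg i).fourier_ae_eq hu.1 (hg2 i)] with ξ hξ
    rw [EuclideanSpace.norm_sq_eq, ENNReal.ofReal_sum_of_nonneg fun i _ => by positivity,
      Finset.sum_mul]
    refine Finset.sum_le_sum fun i _ => ?_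
    rw [hξ i, enorm_mul, enorm_mul, mul_pow, mul_pow]
    have h1 : inner ℝ ξ (basisRd d i) = ξ i := by
      rw [basisRd, EuclideanSpace.inner_single_right]
      simp
    -- The factor `(2π)²` is simply discarded; any positive constant suffices.
    have h2 : (1 : ℝ≥0∞) ≤ ‖(2 * Real.pi * Complex.I : ℂ)‖ₑ := by
      rw [← ofReal_norm, ENNReal.one_le_ofReal]
      simp only [norm_mul, Complex.norm_I, Complex.norm_ofNat, Complex.norm_real, mul_one,
        Real.norm_of_nonneg Real.pi_pos.le]
      linarith [Real.two_le_pi]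
    rw [h1, ← ofReal_norm ((ξ i : ℝ) : ℂ), Complex.norm_real, ENNReal.ofReal_pow (norm_nonneg _)]
    gcongr
    exact le_mul_of_one_le_left (by simp) (one_le_pow₀ h2)
  calc _ ≤ ∫⁻ ξ, ∑ i, ‖(𝓕 ((hg2 i).toLp (g i)) : Lp ℂ 2 (volume : Measure (Rd d))) ξ‖ₑ ^ 2 :=
        lintegral_mono_ae hpt
    _ = ∑ i, ∫⁻ ξ, ‖(𝓕 ((hg2 i).toLp (g i)) : Lp ℂ 2 (volume : Measure (Rd d))) ξ‖ₑ ^ 2 :=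
        lintegral_finsetSum' _ fun i _ =>
          (Lp.aestronglyMeasurable _).enorm.pow_const 2
    _ = _ := by
        refine Finset.sum_congr rfl fun i _ => ?_
        rw [lintegral_enorm_sq_coeFn, ← ofReal_norm, Lp.norm_fourier_eq, ofReal_norm,
          ← lintegral_enorm_sq_coeFn]
        refine lintegral_congr_ae ?_
        filter_upwards [(hg2 i).coeFn_toLp] with x hx
        rw [hx]

/-- Layer cake: for fixed `ξ`, the admissible `E` fill `(0, ‖ξ‖²]`. -/
theorem lintegral_highFreq {h : Rd d → ℂ} (hh : Measurable h) :
    ∫⁻ E in Set.Ioi (0 : ℝ), ∫⁻ ξ in {ξ : Rd d | E ≤ ‖ξ‖ ^ 2}, ‖h ξ‖ₑ ^ 2 =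
      ∫⁻ ξ, ENNReal.ofReal (‖ξ‖ ^ 2) * ‖h ξ‖ₑ ^ 2 := by
  have hS : ∀ E : ℝ, MeasurableSet {ξ : Rd d | E ≤ ‖ξ‖ ^ 2} := fun E =>
    measurableSet_le measurable_const (by fun_prop)
  have hT : MeasurableSet {p : ℝ × Rd d | p.1 ≤ ‖p.2‖ ^ 2} :=
    measurableSet_le (by fun_prop) (by fun_prop)
  simp_rw [← lintegral_indicator (hS _)]
  rw [lintegral_lintegral_swap]
  · refine lintegral_congr fun ξ => ?_
    have h1 : ∀ E : ℝ, {ξ : Rd d | E ≤ ‖ξ‖ ^ 2}.indicator (fun ξ => ‖h ξ‖ₑ ^ 2) ξ =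
        (Set.Iic (‖ξ‖ ^ 2)).indicator (fun _ => ‖h ξ‖ₑ ^ 2) E := fun E => by
      simp [Set.indicator]
    simp_rw [h1]
    rw [lintegral_indicator measurableSet_Iic, lintegral_const, Measure.restrict_restrict
      measurableSet_Iic, Measure.restrict_apply_univ, Set.inter_comm, Set.Ioi_inter_Iic,
      Real.volume_Ioc, sub_zero, mul_comm]
  · refine Measurable.aemeasurable ?_
    have h2 : Measurable fun p : ℝ × Rd d => ‖h p.2‖ₑ ^ 2 := by fun_prop
    exact h2.indicator hT

/-- The volume of the unit ball of `ℝ^d`. -/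
noncomputable def unitBallVolume (d : ℕ) : ℝ := (volume (Metric.ball (0 : Rd d) 1)).toReal

theorem unitBallVolume_pos (d : ℕ) : 0 < unitBallVolume d :=
  ENNReal.toReal_pos (Metric.measure_ball_pos _ _ one_pos).ne' measure_ball_lt_top.ne

/-- A positive constant for which the Lieb-Thirring inequality holds. -/
noncomputable def ruminConstant (d : ℕ) : ℝ :=
  1 / 4 * (1 / (4 * unitBallVolume d)) ^ (2 / (d : ℝ))

theorem ruminConstant_pos (d : ℕ) : 0 < ruminConstant d := by
  have := unitBallVolume_pos d
  unfold ruminConstant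
  positivity

theorem sum_norm_sq_le {κ : Type*} [Fintype κ] (a b : κ → ℂ) :
    ∑ k, ‖a k‖ ^ 2 ≤ 2 * ∑ k, ‖a k - b k‖ ^ 2 + 2 * ∑ k, ‖b k‖ ^ 2 := by
  rw [Finset.mul_sum, Finset.mul_sum, ← Finset.sum_add_distrib]
  refine Finset.sum_le_sum fun k _ => ?_
  have h := norm_add_le (a k - b k) (b k)
  rw [sub_add_cancel] at h
  nlinarith [norm_nonneg (a k), sq_nonneg (‖a k - b k‖ - ‖b k‖)]

/-- Rumin's pointwise bound. -/
theorem ruminConstant_mul_rpow_le (hd : 1 ≤ d) {κ : Type*} [Fintype κ] (a : κ → ℂ)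
    (b : ℝ → κ → ℂ)
    (hb : ∀ E, 0 < E → ∑ k, ‖b E k‖ ^ 2 ≤ √E ^ d * unitBallVolume d) :
    ENNReal.ofReal (ruminConstant d) * (∑ k, ‖a k‖ₑ ^ 2) ^ (1 + 2 / (d : ℝ)) ≤
      ∫⁻ E in Set.Ioi (0 : ℝ), ∑ k, ‖a k - b E k‖ₑ ^ 2 := by
  have hω := unitBallVolume_pos d
  have hd0 : (0 : ℝ) < d := by exact_mod_cast hd
  set ρ : ℝ := ∑ k, ‖a k‖ ^ 2 with hρ
  have hρ0 : 0 ≤ ρ := Finset.sum_nonneg fun k _ => by positivity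
  have hp : 0 ≤ 1 + 2 / (d : ℝ) := by positivity
  -- Chosen so that `t^d * unitBallVolume d = ρ / 4`. For `E ≤ t²` the low part then contributes at
  -- most `ρ / 2` in `sum_norm_sq_le`, so the high part is at least `ρ / 4`; integrating over an
  -- interval of length `t²` gives the constant.
  set t : ℝ := (ρ * (1 / (4 * unitBallVolume d))) ^ (1 / (d : ℝ)) with ht
  have hbase : 0 ≤ ρ * (1 / (4 * unitBallVolume d)) := by positivity
  have ht0 : 0 ≤ t := Real.rpow_nonneg hbase _
  have htd : t ^ d = ρ * (1 / (4 * unitBallVolume d)) := by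
    rw [ht, one_div (d : ℝ), Real.rpow_inv_natCast_pow hbase (by omega)]
  have hconst : ruminConstant d * ρ ^ (1 + 2 / (d : ℝ)) = ρ / 4 * t ^ 2 := by
    have h1 : t ^ 2 = ρ ^ (2 / (d : ℝ)) * (1 / (4 * unitBallVolume d)) ^ (2 / (d : ℝ)) := by
      rw [← Real.mul_rpow hρ0 (by positivity), ht, ← Real.rpow_natCast, ← Real.rpow_mul hbase]
      congr 1
      push_cast
      ring
    rw [h1, ruminConstant, Real.rpow_add' hρ0 (by positivity), Real.rpow_one]
    ring
  have hpt : ∀ E ∈ Set.Ioc (0 : ℝ) (t ^ 2),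
      ENNReal.ofReal (ρ / 4) ≤ ∑ k, ‖a k - b E k‖ₑ ^ 2 := fun E hE => by
    rw [sum_enorm_sq_eq_ofReal]
    refine ENNReal.ofReal_le_ofReal ?_
    have h1 := sum_norm_sq_le a (b E)
    have h2 : √E ^ d ≤ t ^ d := by
      gcongr
      exact Real.sqrt_le_iff.2 ⟨ht0, hE.2⟩
    have h3 : √E ^ d * unitBallVolume d ≤ ρ / 4 := by
      calc _ ≤ t ^ d * unitBallVolume d := by gcongr
        _ = ρ / 4 := by rw [htd]; field_simp
    linarith [hb E hE.1]
  calc _ = ENNReal.ofReal (ρ / 4) * volume (Set.Ioc (0 : ℝ) (t ^ 2)) := by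
        rw [sum_enorm_sq_eq_ofReal, ENNReal.ofReal_rpow_of_nonneg hρ0 hp,
          ← ENNReal.ofReal_mul (ruminConstant_pos d).le, hconst, ENNReal.ofReal_mul (by positivity),
          Real.volume_Ioc, sub_zero]
    _ = ∫⁻ _ in Set.Ioc (0 : ℝ) (t ^ 2), ENNReal.ofReal (ρ / 4) := by
        rw [setLIntegral_const]
    _ ≤ ∫⁻ E in Set.Ioc (0 : ℝ) (t ^ 2), ∑ k, ‖a k - b E k‖ₑ ^ 2 :=
        setLIntegral_mono' measurableSet_Ioc hpt
    _ ≤ _ := lintegral_mono_set Set.Ioc_subset_Ioi_self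

theorem measurable_uncurry_flip {α β γ : Type*} [MeasurableSpace α] [MeasurableSpace β]
    [MeasurableSpace γ] {f : α → β → γ} (hf : Measurable fun p : α × β => f p.1 p.2) :
    Measurable fun p : β × α => f p.2 p.1 :=
  Measurable.comp (g := fun p : α × β => f p.1 p.2) hf measurable_swap

theorem aemeasurable_sub_lowPass {u h : Rd d → ℂ} (hu : AEStronglyMeasurable u volume)
    (hh : Measurable h) (ν : Measure ℝ) [SFinite ν] :
    AEMeasurable (fun p : Rd d × ℝ => ‖u p.1 - lowPass h p.2 p.1‖ₑ ^ 2) (volume.prod ν) := by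
  have h1 : AEMeasurable (fun p : Rd d × ℝ => u p.1) (volume.prod ν) := hu.comp_fst.aemeasurable
  have h2 : Measurable fun p : Rd d × ℝ => lowPass h p.2 p.1 :=
    measurable_uncurry_flip (measurable_lowPass hh)
  have h3 : AEMeasurable (fun p : Rd d × ℝ => u p.1 - lowPass h p.2 p.1) (volume.prod ν) :=
    h1.sub h2.aemeasurable
  exact h3.enorm.pow_const 2

theorem orthonormal_fourier {N : ℕ} {u : Fin N → Rd d → ℂ} (hu : ∀ n, MemLp (u n) 2)
    (ho : OrthonormalL2 u) :
    Orthonormal ℂ fun n => (𝓕 ((hu n).toLp (u n)) : Lp ℂ 2 (volume : Measure (Rd d))) := by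
  rw [orthonormal_iff_ite]
  intro m n
  rw [Lp.inner_fourier_eq, L2.inner_def, ← ho m n]
  refine integral_congr_ae ?_
  filter_upwards [(hu m).coeFn_toLp, (hu n).coeFn_toLp] with x h1 h2
  rw [h1, h2]
  simp [mul_comm]

/-- The Lieb-Thirring inequality (kinetic form), with a non-optimal constant. -/
theorem isLTConstant_ruminConstant (hd : 1 ≤ d) :
    IsLTConstant d (ENNReal.ofReal (ruminConstant d)) := by
  intro N u hu ho
  obtain ⟨h, hh⟩ : ∃ h : Fin N → Lp ℂ 2 (volume : Measure (Rd d)),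
      h = fun n => 𝓕 ((hu n).1.toLp (u n)) := ⟨_, rfl⟩
  have horth : Orthonormal ℂ h := hh ▸ orthonormal_fourier (fun n => (hu n).1) ho
  have hmeas : ∀ n, Measurable (h n) := fun n => (Lp.stronglyMeasurable (h n)).measurable
  have hlow : ∀ x E, 0 < E → ∑ n, ‖lowPass (h n) E x‖ ^ 2 ≤ √E ^ d * unitBallVolume d :=
    fun x E hE => by
    have h1 := sum_enorm_lowPass_sq_le horth E x
    rw [sum_enorm_sq_eq_ofReal, volume_lowFreq hE,
      ← ENNReal.ofReal_toReal (measure_ball_lt_top (μ := volume) (x := (0 : Rd d)) (r := 1)).ne,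
      ← ENNReal.ofReal_mul (by positivity)] at h1
    have := unitBallVolume_pos d
    exact (ENNReal.ofReal_le_ofReal_iff (by positivity)).1 h1
  have hjoint := fun n => aemeasurable_sub_lowPass (hu n).1.aestronglyMeasurable (hmeas n)
    (volume.restrict (Set.Ioi (0 : ℝ)))
  -- Integrate the pointwise bound over `x`, exchange `x` and `E`, apply Plancherel at each `E`, and
  -- finish with the layer cake formula.
  calc _ = ∫⁻ x, ENNReal.ofReal (ruminConstant d) * (∑ n, ‖u n x‖ₑ ^ 2) ^ (1 + 2 / (d : ℝ)) :=
        (lintegral_const_mul' _ _ ENNReal.ofReal_ne_top).symm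
    _ ≤ ∫⁻ x, ∫⁻ E in Set.Ioi (0 : ℝ), ∑ n, ‖u n x - lowPass (h n) E x‖ₑ ^ 2 :=
        lintegral_mono fun x => ruminConstant_mul_rpow_le hd (fun n => u n x)
          (fun E n => lowPass (h n) E x) (hlow x)
    _ = ∫⁻ p : Rd d × ℝ, ∑ n, ‖u n p.1 - lowPass (h n) p.2 p.1‖ₑ ^ 2
          ∂(volume.prod (volume.restrict (Set.Ioi (0 : ℝ)))) :=
        (lintegral_prod _ (Finset.aemeasurable_fun_sum _ fun n _ => hjoint n)).symm
    _ = ∑ n, ∫⁻ p : Rd d × ℝ, ‖u n p.1 - lowPass (h n) p.2 p.1‖ₑ ^ 2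
          ∂(volume.prod (volume.restrict (Set.Ioi (0 : ℝ)))) :=
        lintegral_finsetSum' _ fun n _ => hjoint n
    _ ≤ _ := by
        refine Finset.sum_le_sum fun n _ => ?_
        rw [lintegral_prod_symm _ (hjoint n)]
        have h1 : h n = 𝓕 ((hu n).1.toLp (u n)) := congrFun hh n
        have h2 : ∀ E, ∫⁻ x, ‖u n x - lowPass (h n) E x‖ₑ ^ 2 =
            ∫⁻ ξ in {ξ : Rd d | E ≤ ‖ξ‖ ^ 2}, ‖h n ξ‖ₑ ^ 2 := fun E => by
          rw [h1]
          exact lintegral_sub_lowPass (hu n).1 E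
        simp_rw [h2]
        rw [lintegral_highFreq (hmeas n), h1]
        exact lintegral_norm_sq_mul_fourier_le (hu n)

end Rumin

/-! ### The optimal constant and the final statement -/

/-- The supremum is attained, since multiplication by a fixed element of `ℝ≥0∞` commutes with
suprema. -/
theorem isLTConstant_optimalK (d : ℕ) : IsLTConstant d (optimalK d) := by
  intro N u hu ho
  rw [optimalK, ENNReal.sSup_mul]
  exact iSup₂_le fun K hK => hK N u hu ho

theorem optimalK_pos (hd : 1 ≤ d) : 0 < optimalK d :=
  (ENNReal.ofReal_pos.2 (ruminConstant_pos d)).trans_le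
    (le_sSup (isLTConstant_ruminConstant hd))

theorem MemH1.kineticEnergy_lt_top {u : Rd d → ℂ} (hu : MemH1 (basisRd d) u) :
    kineticEnergy (basisRd d) u < ⊤ := by
  choose g hg hg2 using hu.2
  rw [kineticEnergy_eq hg]
  exact ENNReal.sum_lt_top.2 fun i _ => (memLp_two_iff_lintegral.1 (hg2 i)).2

theorem memH1_of_contDiff {f : Rd d → ℝ} (hf : ContDiff ℝ ∞ f) (hc : HasCompactSupport f) :
    MemH1 (basisRd d) fun x => (f x : ℂ) := by
  have h1 : MemLp (fun x => (f x : ℂ)) 2 :=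
    memLp_two_of_continuous_hasCompactSupport hf.continuous hc
  have hcd : ∀ φ : Rd d → ℝ, ContDiff ℝ ∞ φ → ∀ v, Continuous fun x => fderiv ℝ φ x v :=
    fun φ hφ v => (hφ.continuous_fderiv (by simp)).clm_apply continuous_const
  have h2 : ∀ v, MemLp (fun x => ((fderiv ℝ f x v : ℝ) : ℂ)) 2 := fun v =>
    memLp_two_of_continuous_hasCompactSupport (hcd f hf v) (hc.fderiv_apply ℝ v)
  refine ⟨h1, fun i => ⟨_, ⟨h1.locallyIntegrable (by norm_num),
    (h2 (basisRd d i)).locallyIntegrable (by norm_num), fun φ hφ hφc => ?_⟩, h2 (basisRd d i)⟩⟩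
  have h3 := integral_mul_fderiv_eq_neg_fderiv_mul_of_integrable (𝕜 := ℝ) (μ := volume)
    (f := φ) (g := f) (v := basisRd d i)
    (((hcd φ hφ _).mul hf.continuous).integrable_of_hasCompactSupport hc.mul_left)
    ((hφ.continuous.mul (hcd f hf _)).integrable_of_hasCompactSupport hφc.mul_right)
    ((hφ.continuous.mul hf.continuous).integrable_of_hasCompactSupport hφc.mul_right)
    (fun x _ => hφ.differentiable (by simp) x) (fun x _ => hf.differentiable (by simp) x)
  simp only [Complex.real_smul, ← Complex.ofReal_mul]
  rw [integral_complex_ofReal, integral_complex_ofReal, h3]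
  simp

theorem exists_memH1_normalized (d : ℕ) :
    ∃ u : Rd d → ℂ, MemH1 (basisRd d) u ∧ ∫ x, star (u x) * u x = 1 := by
  let χ : ContDiffBump (0 : Rd d) := ⟨1, 2, one_pos, one_lt_two⟩
  have hχ := memH1_of_contDiff χ.contDiff χ.hasCompactSupport
  have h1 := integral_star_mul_self hχ.1
  have hpos : 0 < (∫⁻ x, ‖(χ x : ℂ)‖ₑ ^ 2).toReal := by
    refine ENNReal.toReal_pos (fun h0 => ?_) (memLp_two_iff_lintegral.1 hχ.1).2.ne
    rw [lintegral_eq_zero_iff' (hχ.1.aestronglyMeasurable.enorm.pow_const 2)] at h0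
    have h2 : (fun x => (χ x : ℂ)) =ᵐ[volume] fun _ => 0 := by
      filter_upwards [h0] with x hx
      simpa using hx
    have h3 := (Continuous.ae_eq_iff_eq volume (Complex.continuous_ofReal.comp χ.continuous)
      continuous_const).1 h2
    have h4 := congrFun h3 0
    have h5 : χ (0 : Rd d) = 1 := χ.one_of_mem_closedBall (by simp [χ])
    rw [Function.comp_apply, h5] at h4
    simp at h4
  set m : ℝ := (∫⁻ x, ‖(χ x : ℂ)‖ₑ ^ 2).toReal
  refine ⟨fun x => (((√m)⁻¹ : ℝ) : ℂ) * χ x, hχ.const_mul _, ?_⟩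
  have h2 : ∀ x, star ((((√m)⁻¹ : ℝ) : ℂ) * χ x) * ((((√m)⁻¹ : ℝ) : ℂ) * χ x) =
      ((m⁻¹ : ℝ) : ℂ) * (star (χ x : ℂ) * χ x) := fun x => by
    have h3 : (m⁻¹ : ℝ) = (√m)⁻¹ * (√m)⁻¹ := by
      rw [← mul_inv, Real.mul_self_sqrt hpos.le]
    rw [star_mul, h3]
    push_cast
    simp
    ring
  simp_rw [h2]
  rw [integral_const_mul, h1, ← Complex.ofReal_mul, inv_mul_cancel₀ hpos.ne', Complex.ofReal_one]

/-- A single normalised `H^1` function has finite kinetic energy and a nonzero density integral,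
which excludes an infinite constant. -/
theorem optimalK_lt_top (d : ℕ) : optimalK d < ⊤ := by
  obtain ⟨u, hu, hn⟩ := exists_memH1_normalized d
  have hp : 0 < 1 + 2 / (d : ℝ) := by positivity
  have hI : ∫⁻ x, (‖u x‖ₑ ^ 2) ^ (1 + 2 / (d : ℝ)) ≠ 0 := fun h0 => by
    rw [lintegral_eq_zero_iff'
      ((hu.1.aestronglyMeasurable.enorm.pow_const 2).pow_const _)] at h0
    have h1 : ∫ x, star (u x) * u x = 0 := by
      refine integral_eq_zero_of_ae ?_
      filter_upwards [h0] with x hx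
      have h2 : u x = 0 := by simpa [ENNReal.rpow_eq_zero_iff, hp, hp.not_gt] using hx
      simp [h2]
    exact one_ne_zero (hn.symm.trans h1)
  have hle : optimalK d * ∫⁻ x, (‖u x‖ₑ ^ 2) ^ (1 + 2 / (d : ℝ)) ≤
      kineticEnergy (basisRd d) u := by
    have := isLTConstant_optimalK d 1 (fun _ => u) (fun _ => hu)
      (fun m n => by rw [Subsingleton.elim m n, if_pos rfl, hn])
    simpa using this
  by_contra h
  rw [not_lt, top_le_iff] at h
  rw [h, ENNReal.top_mul hI, top_le_iff] at hle
  exact hu.kineticEnergy_lt_top.ne hle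

theorem density_ae_eq_zero {N : ℕ} {ψ : Config d N → ℂ} (h : ψ =ᵐ[volume] 0) :
    ∀ᵐ x, density ψ x = 0 := by
  have h1 : ∀ n : Fin N, ∀ᵐ x : Rd d, ∀ᵐ y : Others d n, ψ (insertParticle n x y) = 0 := fun n =>
    Measure.ae_ae_of_ae_prod ((measurePreserving_insertParticle n).quasiMeasurePreserving.ae h)
  filter_upwards [ae_all_iff.2 h1] with x hx
  refine Finset.sum_eq_zero fun n _ => ?_
  rw [lintegral_congr_ae (g := fun _ => 0) (by filter_upwards [hx n] with y hy; simp [hy]),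
    lintegral_zero]

end LiebThirring

theorem mainTheorem4 (d : ℕ) (hd : 1 ≤ d) :
    0 < LiebThirring.optimalK d ∧ LiebThirring.optimalK d < ⊤ ∧
    LiebThirring.IsLTConstant d (LiebThirring.optimalK d) ∧
    ∀ (N : ℕ), 1 ≤ N → ∀ ψ : LiebThirring.Config d N → ℂ,
      LiebThirring.MemH1 (LiebThirring.basisConfig d N) ψ → LiebThirring.Antisymmetric ψ →
        LiebThirring.optimalK d * eLpNorm ψ 2 volume ^ (-4 / (d : ℝ)) *
            ∫⁻ x, LiebThirring.density ψ x ^ (1 + 2 / (d : ℝ)) ≤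
          LiebThirring.kineticEnergy (LiebThirring.basisConfig d N) ψ := by
  refine ⟨LiebThirring.optimalK_pos hd, LiebThirring.optimalK_lt_top d,
    LiebThirring.isLTConstant_optimalK d, fun N _ ψ hψ hanti => ?_⟩
  have hp : 0 < 1 + 2 / (d : ℝ) := by positivity
  by_cases h0 : eLpNorm ψ 2 volume = 0
  -- Here the negative power of the norm is `⊤`, but the density vanishes almost everywhere and `⊤ *
  -- 0 = 0`, which is the convention required for `ψ = 0`.
  · rw [eLpNorm_eq_zero_iff hψ.1.aestronglyMeasurable (by simp)] at h0
    have h1 : ∫⁻ x, LiebThirring.density ψ x ^ (1 + 2 / (d : ℝ)) = 0 := by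
      rw [lintegral_congr_ae (g := fun _ => 0) (by
        filter_upwards [LiebThirring.density_ae_eq_zero h0] with x hx
        rw [hx, ENNReal.zero_rpow_of_pos hp]), lintegral_zero]
    rw [h1, mul_zero]
    exact zero_le
  · have hL := hψ.1.2.ne
    have h1 := (LiebThirring.isLTConstant_optimalK d).antisymmetric hψ hanti
      (by rw [← LiebThirring.eLpNorm_two_sq]; exact pow_ne_zero 2 h0)
    rw [← LiebThirring.eLpNorm_two_sq, ← ENNReal.rpow_natCast, ← ENNReal.rpow_mul] at h1
    calc LiebThirring.optimalK d * eLpNorm ψ 2 volume ^ (-4 / (d : ℝ)) *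
          ∫⁻ x, LiebThirring.density ψ x ^ (1 + 2 / (d : ℝ))
        = eLpNorm ψ 2 volume ^ (-4 / (d : ℝ)) * (LiebThirring.optimalK d *
          ∫⁻ x, LiebThirring.density ψ x ^ (1 + 2 / (d : ℝ))) := by ring
      _ ≤ eLpNorm ψ 2 volume ^ (-4 / (d : ℝ)) *
          (eLpNorm ψ 2 volume ^ (((2 : ℕ) : ℝ) * (2 / (d : ℝ))) *
            LiebThirring.kineticEnergy (LiebThirring.basisConfig d N) ψ) := by gcongr
      _ = _ := by
        rw [← mul_assoc, ← ENNReal.rpow_add _ _ h0 hL]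
        have : -4 / (d : ℝ) + ((2 : ℕ) : ℝ) * (2 / (d : ℝ)) = 0 := by push_cast; ring
        rw [this, ENNReal.rpow_zero, one_mul]
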